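/- Let $X$ be a real random variable with law $P$, mean $\mu$ and variance $\sigma^2$, such that $\mathbb E|X-\mu|^{1+\delta}<\infty$ for some $\delta\in[1,2]$, and let $X_1,X_2,\dots$ be independent copies of $X$ (no outliers). Put $g(u)=\mathbb E\big(|X|^{1+\delta}\mathbf 1\{|X|\ge u\}\big)$ and $$\phi(\delta,n)=n^{-\delta/2}\Big(n^{-\frac{2-\delta}{4}}\vee g(n^{1/4})^{\frac{2-\delta}{2+\delta}}\Big).$$ Given $N=kn$ and a partition $G_1,\dots,G_k$ of $\{1,\dots,N\}$ into blocks of size $n$, let $\bar\mu_i=\frac1n\sum_{l\in G_i}X_l$, $\widehat\sigma_i^2=\frac1n\sum_{l\in G_i}(X_l-\bar\mu_i)^2$, and for $p\ge1$ $$\widehat\mu_{N,p}=\sum_{i=1}^k\alpha_i\bar\mu_i,\qquad \alpha_i=\frac{1/\widehat\sigma_i^p}{\sum_{l=1}^k1/\widehat\sigma_l^p},$$ where, if some $\widehat\sigma_i$ vanish, the blocks with $\widehat\sigma_i=0$ share the total weight $1$ equally. Let $(k_j)$ and $(n_j)$ be sequences of natural numbers tending to infinity such that, with $N_j=k_jn_j$,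 $\sqrt{N_j}\,\phi(\delta,n_j)\to0$ as $j\to\infty$. Then for every $p\ge1$ (and any choice of the partitions) $$\sqrt{N_j}\,\big(\widehat\mu_{N_j,p}-\mu\big)\xrightarrow{d}\mathcal N(0,\sigma^2)\qquad\text{as }j\to\infty .$$ So the estimator is asymptotically efficient, in the sense that its asymptotic variance at $P$ is the minimax one: $$\sigma^2=\inf_{\widetilde\mu}\ \sup_{Q\in\mathcal P_{2,\sigma}}\nu^2(\widetilde\mu,Q),$$ where $\mathcal P_{2,\sigma}$ is the set of laws on $\mathbb R$ with finite second moment and variance $\sigma^2$, and the infimum is over all sequences $\widetilde\mu=(\widetilde\mu_N)_N$ of measurable functions of $N$ independent observations such that, for each $Q\in\mathcal P_{2,\sigma}$ with mean $\mu_Q$, $\sqrt N(\widetilde\mu_N-\mu_Q)\xrightarrow{d}\mathcal N(0,\nu^2(\widetilde\mu,Q))$ under $Q$ as $N\to\infty$. -/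

import Mathlib

open MeasureTheory ProbabilityTheory Filter Topology
open scoped NNReal ENNReal

noncomputable section

/-- Sample mean of the observations `x i`, `i ∈ G`. -/
def blockMean (G : Finset ℕ) (x : ℕ → ℝ) : ℝ :=
  (∑ i ∈ G, x i) / (G.card : ℝ)

/-- Sample standard deviation (normalised by `|G|`) of the observations `x i`, `i ∈ G`. -/
def blockStd (G : Finset ℕ) (x : ℕ → ℝ) : ℝ :=
  Real.sqrt ((∑ i ∈ G, (x i - blockMean G x) ^ 2) / (G.card : ℝ))

open Classical in
/-- Unnormalised weights: `1 / s i ^ p` when all the `s l` are nonzero. Otherwise `1 / 0 ^ p` is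
read as `+∞`, so that the blocks with `s i = 0` share the total weight equally. -/
def rawWeight (p : ℝ) {k : ℕ} (s : Fin k → ℝ) (i : Fin k) : ℝ :=
  if ∃ l, s l = 0 then (if s i = 0 then 1 else 0) else 1 / s i ^ p

/-- Normalised weights `α_i`. -/
def blockWeight (p : ℝ) {k : ℕ} (s : Fin k → ℝ) (i : Fin k) : ℝ :=
  rawWeight p s i / ∑ l, rawWeight p s l

/-- The estimator `∑ i, α_i * (mean of block i)`, where `α_i` is proportional to the inverse of the
`p`-th power of the sample standard deviation of block `i`. -/
def weightedBlockEstimator (p : ℝ) {k : ℕ} (G : Fin k → Finset ℕ) (x : ℕ → ℝ) : ℝ :=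
  ∑ i, blockWeight p (fun l => blockStd (G l) x) i * blockMean (G i) x

/-- `G` partitions `{0, …, k * n - 1}` into `k` blocks of cardinality `n`. -/
structure IsBlockPartition (k n : ℕ) (G : Fin k → Finset ℕ) : Prop where
  card_eq : ∀ i, (G i).card = n
  pairwise_disjoint : Pairwise fun i l => Disjoint (G i) (G l)
  cover : Finset.univ.biUnion G = Finset.range (k * n)

/-- `g(u) = E (|X| ^ (1 + δ) 1{|X| ≥ u})` for `X` with law `P`. -/
def tailMoment (P : Measure ℝ) (δ u : ℝ) : ℝ :=
  ∫ x in {x : ℝ | u ≤ |x|}, |x| ^ (1 + δ) ∂P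

/-- `φ(δ, n) = n ^ (-δ/2) * max (n ^ (-(2-δ)/4)) (g (n ^ (1/4)) ^ ((2-δ)/(2+δ)))`. -/
def biasRate (P : Measure ℝ) (δ : ℝ) (n : ℕ) : ℝ :=
  (n : ℝ) ^ (-δ / 2) *
    max ((n : ℝ) ^ (-(2 - δ) / 4))
      (tailMoment P δ ((n : ℝ) ^ (1 / 4 : ℝ)) ^ ((2 - δ) / (2 + δ)))

/-- The laws on `ℝ` with finite second moment and variance `σ ^ 2`. -/
def finiteVarianceClass (σ : ℝ≥0) : Set (ProbabilityMeasure ℝ) :=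
  {Q | MemLp (fun x : ℝ => x) 2 (Q : Measure ℝ) ∧
    variance (fun x : ℝ => x) (Q : Measure ℝ) = (σ : ℝ) ^ 2}

/-- The estimators `T N`, computed from `N` independent observations with law `Q`, satisfy
`√N (T N - mean of Q) → N(0, v)` in distribution. -/
def IsAsymptoticallyNormal (T : (N : ℕ) → (Fin N → ℝ) → ℝ) (Q : ProbabilityMeasure ℝ)
    (v : ℝ≥0) : Prop :=
  TendstoInDistribution
    (fun (N : ℕ) (x : Fin N → ℝ) => Real.sqrt N * (T N x - ∫ y, y ∂(Q : Measure ℝ)))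
    atTop (fun z : ℝ => z)
    (fun N => Measure.pi fun _ : Fin N => (Q : Measure ℝ)) (gaussianReal 0 v)

/-- The smallest worst-case asymptotic variance over the laws with variance `σ ^ 2`, among all
sequences of estimators of the mean that are asymptotically normal at each of these laws; `ν Q` is
the asymptotic variance at the law `Q`. -/
def minimaxAsymptoticVariance (σ : ℝ≥0) : ℝ≥0∞ :=
  ⨅ (T : (N : ℕ) → (Fin N → ℝ) → ℝ) (ν : ProbabilityMeasure ℝ → ℝ≥0)
    (_ : ∀ N, Measurable (T N))
    (_ : ∀ Q ∈ finiteVarianceClass σ, IsAsymptoticallyNormal T Q (ν Q)),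
    ⨆ Q ∈ finiteVarianceClass σ, (ν Q : ℝ≥0∞)

end

/-!
**Asymptotic normality.** Centre the observations, and let `V i`, `m i` be the variance and the mean
of block `i`. Off an event of small probability all `V i` are at least `σ² / 4`
(`exists_measureReal_blockVar_lt_le`, a union bound, and `k / n → 0`), and there the weights are
`f (V i)` with `f x = max x (σ² / 4) ^ (-p / 2)`, which is bounded and Lipschitz. With `c = f (σ²)`, the
normalised estimator is `(R + c Z) / W`, where `Z` is the normalised sample mean, `W` is the average
of the `f (V i)`, and `R = (√N / k) ∑ (f (V i) - c) m i`. The central limit theorem applies to `Z`, and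
`W → c` by a law of large numbers, so by Slutsky's theorem it is enough that `R → 0` in probability.
The variance of `R` vanishes because `n (m i)²` is uniformly integrable and `f (V i) → c`
(`exists_forall_integral_sq_mul_blockMean_le`). For its mean, compare the block variance with the
one that omits a single observation (`abs_integral_mul_comp_blockVar_le`): the mean of `f (V i) m i` is
of the order of `E (|Y| min(1, Y² / n)) + 1 / n`, and this is `O(biasRate)`
(`exists_integral_truncated_le_biasRate`). Bounds for single blocks hold uniformly over all blocks
of a given size, so no identification of the laws of different blocks is needed.

**Minimax variance.** The sample mean attains `σ²`. Conversely, restrict an asymptotically normal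
estimator to the laws `N(θ, σ²)` and put a standard Gaussian prior on `θ`. The posterior mean has a
Gaussian error independent of the data, of variance `σ² / (σ² + N)`, so the mean of
`cos (√N (T - θ))` is at most `exp (-N σ² / (2 (σ² + N)))`. It tends to the prior mean of
`exp (-ν θ / 2)`, so that `ν` cannot be bounded by a number less than `σ²`
(`variance_le_of_isAsymptoticallyNormal`).
-/

/-! ### The Gaussian location model -/

/-- The location parameter `z.1 ∼ N(0, 1)` and the noise `z.2 ∼ N(0, v)^N` are jointly Gaussian. -/
lemma hasGaussianLaw_prior_prod_noise (v : ℝ≥0) (N : ℕ) :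
    HasGaussianLaw (fun z : ℝ × (Fin N → ℝ) => z)
      ((gaussianReal 0 1).prod (Measure.pi fun _ : Fin N => gaussianReal 0 v)) := by
  have h : HasGaussianLaw (fun ξ : Fin N → ℝ => ξ)
      (Measure.pi fun _ : Fin N => gaussianReal 0 v) :=
    (iIndepFun_pi (X := fun (_ : Fin N) (x : ℝ) => x) (μ := fun _ : Fin N => gaussianReal 0 v)
      (fun i => aemeasurable_id)).hasGaussianLaw
      fun i => (HasLaw.mk (measurable_pi_apply i).aemeasurable ((measurePreserving_eval
        (fun _ : Fin N => gaussianReal 0 v) i).map_eq)).hasGaussianLaw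
  have : IsGaussian (Measure.pi fun _ : Fin N => gaussianReal 0 v) := by
    have := h.isGaussian_map
    rwa [Measure.map_id'] at this
  exact IsGaussian.hasGaussianLaw_id

lemma covariance_prior_noise (v : ℝ≥0) (N : ℕ) (i : Fin N) :
    cov[fun z : ℝ × (Fin N → ℝ) => z.1, fun z => z.2 i;
      (gaussianReal 0 1).prod (Measure.pi fun _ : Fin N => gaussianReal 0 v)] = 0 := by
  refine IndepFun.covariance_eq_zero ?_ ?_ ?_
  · exact indepFun_prod (X := fun x : ℝ => x) (Y := fun ξ : Fin N → ℝ => ξ i)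
      measurable_id (measurable_pi_apply i)
  · exact ((hasGaussianLaw_prior_prod_noise v N).fst).memLp_two
  · exact ((hasGaussianLaw_prior_prod_noise v N).snd.eval i).memLp_two

lemma hasLaw_noise (v : ℝ≥0) (N : ℕ) (i : Fin N) :
    HasLaw (fun z : ℝ × (Fin N → ℝ) => z.2 i) (gaussianReal 0 v)
      ((gaussianReal 0 1).prod (Measure.pi fun _ : Fin N => gaussianReal 0 v)) := by
  refine ⟨by fun_prop, ?_⟩
  exact (((measurePreserving_eval (fun _ : Fin N => gaussianReal 0 v) i)).comp
    measurePreserving_snd).map_eq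

lemma covariance_noise_noise (v : ℝ≥0) (N : ℕ) (i j : Fin N) :
    cov[fun z : ℝ × (Fin N → ℝ) => z.2 i, fun z => z.2 j;
      (gaussianReal 0 1).prod (Measure.pi fun _ : Fin N => gaussianReal 0 v)] =
      if i = j then (v : ℝ) else 0 := by
  set γ := Measure.pi fun _ : Fin N => gaussianReal 0 v
  set ρ := (gaussianReal 0 1).prod γ
  split_ifs with h
  · subst h
    rw [covariance_self (by fun_prop), (hasLaw_noise v N i).variance_eq, variance_id_gaussianReal]
  · refine IndepFun.covariance_eq_zero ?_ ((hasGaussianLaw_prior_prod_noise v N).snd.eval i).memLp_two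
      ((hasGaussianLaw_prior_prod_noise v N).snd.eval j).memLp_two
    have h1 : IndepFun (fun ξ : Fin N → ℝ => ξ i) (fun ξ => ξ j) γ :=
      (iIndepFun_pi (X := fun (_ : Fin N) (x : ℝ) => x) (μ := fun _ : Fin N => gaussianReal 0 v)
        (fun i => aemeasurable_id)).indepFun h
    have h2 : IndepFun (fun ξ : Fin N → ℝ => ξ i) (fun ξ => ξ j) (ρ.map Prod.snd) := by
      rwa [(measurePreserving_snd (μ := gaussianReal 0 1) (ν := γ)).map_eq]
    have hm : ∀ (κ : Measure (Fin N → ℝ)) (i : Fin N), AEMeasurable (fun ξ : Fin N → ℝ => ξ i) κ :=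
      fun κ i => (measurable_pi_apply i).aemeasurable
    rw [indepFun_iff_map_prod_eq_prod_map_map (hm _ i) (hm _ j)] at h2
    rw [indepFun_iff_map_prod_eq_prod_map_map (by fun_prop) (by fun_prop)]
    rw [Measure.map_map (by fun_prop) (by fun_prop), Measure.map_map (by fun_prop) (by fun_prop),
      Measure.map_map (by fun_prop) (by fun_prop)] at h2
    exact h2

/-- The loss `1 - cos` needs no analogue of Anderson's lemma: if `W ∼ N(0, τ)` is independent of `U`,
then the mean of `cos (U - b W)` is the real part of the product of two characteristic functions,
of which the first has modulus at most one. -/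
lemma integral_cos_sub_le {Ω : Type*} [MeasurableSpace Ω] {ρ : Measure Ω}
    [IsProbabilityMeasure ρ] {U W : Ω → ℝ} {τ : ℝ≥0} (hU : Measurable U) (hWm : Measurable W)
    (hUW : IndepFun W U ρ) (hW : HasLaw W (gaussianReal 0 τ) ρ) (b : ℝ) :
    ∫ ω, Real.cos (U ω - b * W ω) ∂ρ ≤ Real.exp (-(τ * b ^ 2 / 2)) := by
  have hre : ∀ ω, Real.cos (U ω - b * W ω) =
      (Complex.exp (U ω * Complex.I) * Complex.exp (((-b : ℝ) : ℂ) * W ω * Complex.I)).re := by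
    intro ω
    rw [← Complex.exp_add, ← Complex.exp_ofReal_mul_I_re]
    congr 2
    push_cast
    ring
  have hind : IndepFun (fun ω => Complex.exp (U ω * Complex.I))
      (fun ω => Complex.exp (((-b : ℝ) : ℂ) * W ω * Complex.I)) ρ :=
    hUW.symm.comp (φ := fun u : ℝ => Complex.exp (u * Complex.I))
      (ψ := fun w : ℝ => Complex.exp (((-b : ℝ) : ℂ) * w * Complex.I)) (by fun_prop) (by fun_prop)
  have hint : Integrable (fun ω => Complex.exp (U ω * Complex.I) *
      Complex.exp (((-b : ℝ) : ℂ) * W ω * Complex.I)) ρ := by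
    refine Integrable.of_bound (by fun_prop) 1 (ae_of_all _ fun ω => ?_)
    rw [norm_mul, Complex.norm_exp_ofReal_mul_I, ← Complex.ofReal_mul,
      Complex.norm_exp_ofReal_mul_I, one_mul]
  have hchar : ∫ ω, Complex.exp (((-b : ℝ) : ℂ) * W ω * Complex.I) ∂ρ =
      Complex.exp (-(τ * b ^ 2 / 2) : ℝ) := by
    have := hW.integral_comp (f := fun w : ℝ => Complex.exp (((-b : ℝ) : ℂ) * w * Complex.I))
      (by fun_prop)
    rw [Function.comp_def] at this
    rw [this, ← charFun_apply_real, charFun_gaussianReal]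
    congr 1
    push_cast
    ring
  simp_rw [hre]
  have hcomm := integral_re hint
  simp only [RCLike.re_to_complex] at hcomm
  rw [hcomm, hind.integral_fun_mul_eq_mul_integral (by fun_prop) (by fun_prop), hchar]
  refine (Complex.re_le_norm _).trans ?_
  rw [norm_mul, ← Complex.ofReal_exp, Complex.norm_real, Real.norm_of_nonneg (Real.exp_nonneg _)]
  refine mul_le_of_le_one_left (Real.exp_nonneg _) ?_
  refine (norm_integral_le_integral_norm _).trans ?_
  simp [Complex.norm_exp_ofReal_mul_I]

/-- Bayes bound for the estimation of the location parameter `θ = z.1` from the observations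
`θ + z.2 i` in the loss `1 - cos`. The posterior mean of `θ` is `∑ X i / (v + N)`, and the
error `W` of the posterior mean is independent of the data, with variance `v / (v + N)`. -/
lemma integral_cos_estimation_error_le (v : ℝ≥0) (hv : v ≠ 0) (N : ℕ) (T : (Fin N → ℝ) → ℝ)
    (hT : Measurable T) :
    ∫ z : ℝ × (Fin N → ℝ), Real.cos (Real.sqrt N * (T (fun i => z.1 + z.2 i) - z.1))
      ∂(gaussianReal 0 1).prod (Measure.pi fun _ : Fin N => gaussianReal 0 v) ≤
      Real.exp (-((v / (v + N) : ℝ≥0) * N / 2)) := by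
  set ρ := (gaussianReal 0 1).prod (Measure.pi fun _ : Fin N => gaussianReal 0 v)
  have hv0 : (0 : ℝ) < v := by positivity
  have hD : (0 : ℝ) < v + N := by positivity
  let W : ℝ × (Fin N → ℝ) → ℝ := fun z => (v / (v + N) : ℝ) * z.1 - ∑ i, (1 / (v + N) : ℝ) * z.2 i
  let X : ℝ × (Fin N → ℝ) → Fin N → ℝ := fun z i => z.1 + z.2 i
  have hθ : MemLp (fun z : ℝ × (Fin N → ℝ) => z.1) 2 ρ := (hasGaussianLaw_prior_prod_noise v N).fst.memLp_two
  have hξ : ∀ i, MemLp (fun z : ℝ × (Fin N → ℝ) => z.2 i) 2 ρ :=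
    fun i => ((hasGaussianLaw_prior_prod_noise v N).snd.eval i).memLp_two
  have hξ' : ∀ i, MemLp (fun z : ℝ × (Fin N → ℝ) => (1 / (v + N) : ℝ) * z.2 i) 2 ρ :=
    fun i => (hξ i).const_mul _
  have hS : MemLp (fun z : ℝ × (Fin N → ℝ) => ∑ i, (1 / (v + N) : ℝ) * z.2 i) 2 ρ :=
    memLp_finsetSum _ fun i _ => hξ' i
  have hθ' : MemLp (fun z : ℝ × (Fin N → ℝ) => (v / (v + N) : ℝ) * z.1) 2 ρ := hθ.const_mul _
  have hvarθ : cov[fun z : ℝ × (Fin N → ℝ) => z.1, fun z => z.1; ρ] = 1 := by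
    rw [covariance_self (by fun_prop),
      (HasLaw.mk (by fun_prop) (measurePreserving_fst.map_eq) : HasLaw
        (fun z : ℝ × (Fin N → ℝ) => z.1) (gaussianReal 0 1) ρ).variance_eq,
      variance_id_gaussianReal]
    simp
  have hWθ : cov[W, fun z => z.1; ρ] = v / (v + N) := by
    rw [covariance_fun_sub_left hθ' hS hθ, covariance_const_mul_left, hvarθ,
      covariance_fun_sum_left hξ' hθ, Finset.sum_eq_zero, sub_zero, mul_one]
    intro i _
    rw [covariance_const_mul_left, covariance_comm, covariance_prior_noise, mul_zero]
  have hWξ : ∀ j, cov[W, fun z => z.2 j; ρ] = -(v / (v + N)) := by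
    intro j
    rw [covariance_fun_sub_left hθ' hS (hξ j), covariance_const_mul_left, covariance_prior_noise,
      covariance_fun_sum_left hξ' (hξ j)]
    simp_rw [covariance_const_mul_left]
    simp only [ρ, covariance_noise_noise]
    simp [field]
  have hL : HasGaussianLaw (fun z => ((fun _ : Unit => W z), X z)) ρ := by
    let L : (ℝ × (Fin N → ℝ)) →L[ℝ] ((Unit → ℝ) × (Fin N → ℝ)) :=
      ContinuousLinearMap.prod
        (ContinuousLinearMap.pi fun _ : Unit =>
          (v / (v + N) : ℝ) • ContinuousLinearMap.fst ℝ ℝ (Fin N → ℝ) -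
          ∑ i, (1 / (v + N) : ℝ) •
            ((ContinuousLinearMap.proj i).comp (ContinuousLinearMap.snd ℝ ℝ (Fin N → ℝ))))
        (ContinuousLinearMap.pi fun i : Fin N => ContinuousLinearMap.fst ℝ ℝ (Fin N → ℝ) +
          (ContinuousLinearMap.proj i).comp (ContinuousLinearMap.snd ℝ ℝ (Fin N → ℝ)))
    have hLz : (fun z => ((fun _ : Unit => W z), X z)) = L ∘ fun z => z := by
      ext z
      · simp [L, W]
      · simp [L, X]
    rw [hLz]
    exact (hasGaussianLaw_prior_prod_noise v N).map L
  have hWm : MemLp W 2 ρ := hθ'.sub hS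
  -- uncorrelated and jointly Gaussian, hence independent
  have hind : IndepFun W X ρ := by
    have := hL.indepFun_of_covariance_eval (X := fun (_ : Unit) z => W z)
      (Y := fun i z => X z i) ?_
    · exact this.comp (φ := fun f : Unit → ℝ => f ()) (ψ := fun x => x) (by fun_prop) measurable_id
    · intro _ j
      change cov[W, fun z => z.1 + z.2 j; ρ] = 0
      have := covariance_add_right hWm hθ (hξ j)
      rw [hWθ, hWξ, add_neg_cancel] at this
      exact this
  have hvarW : Var[W; ρ] = ((v / (v + N) : ℝ≥0) : ℝ) := by
    rw [← covariance_self (by fun_prop), covariance_fun_sub_right hWm hθ' hS,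
      covariance_const_mul_right, hWθ, covariance_fun_sum_right hξ' hWm]
    simp_rw [covariance_const_mul_right, hWξ]
    simp [field]
  have hmean : ρ[W] = 0 := by
    have h1 : ∫ z, z.1 ∂ρ = 0 := by
      rw [(HasLaw.mk (by fun_prop) (measurePreserving_fst.map_eq) : HasLaw
        (fun z : ℝ × (Fin N → ℝ) => z.1) (gaussianReal 0 1) ρ).integral_eq,
        integral_id_gaussianReal]
    have h2 : ∀ i, ∫ z, z.2 i ∂ρ = 0 := by
      intro i
      rw [(hasLaw_noise v N i).integral_eq, integral_id_gaussianReal]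
    rw [integral_sub (hθ'.integrable one_le_two) (hS.integrable one_le_two), integral_const_mul, h1,
      integral_finsetSum _ fun i _ => (hξ' i).integrable one_le_two]
    simp [integral_const_mul, h2]
  have hWlaw : HasLaw W (gaussianReal 0 (v / (v + N))) ρ := by
    refine ⟨by fun_prop, ?_⟩
    have h1 : HasGaussianLaw W ρ := hL.fst.eval ()
    rw [h1.map_eq_gaussianReal, hmean, hvarW, Real.toNNReal_coe]
  have hXm : Measurable X := by fun_prop
  have := integral_cos_sub_le (ρ := ρ)
    (U := fun z => Real.sqrt N * (T (X z) - ∑ i, (1 / (v + N) : ℝ) * X z i)) (W := W)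
    (by fun_prop) (by fun_prop)
    (hind.comp (φ := fun w => w)
      (ψ := fun x : Fin N → ℝ => Real.sqrt N * (T x - ∑ i, (1 / (v + N) : ℝ) * x i))
      measurable_id (by fun_prop)) hWlaw (Real.sqrt N)
  rw [Real.sq_sqrt (Nat.cast_nonneg _)] at this
  refine le_of_eq_of_le (integral_congr_ae (ae_of_all _ fun z => ?_)) this
  simp only [W, X, mul_add, Finset.sum_add_distrib]
  congr 1
  simp
  field_simp
  ring

lemma integral_cos_gaussianReal (ν : ℝ≥0) :
    ∫ z, Real.cos z ∂gaussianReal 0 ν = Real.exp (-(ν / 2)) := by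
  have h := charFun_gaussianReal (μ := 0) (v := ν) 1
  rw [charFun_apply_real] at h
  have hint : Integrable (fun x : ℝ => Complex.exp (((1 : ℝ) : ℂ) * x * Complex.I))
      (gaussianReal 0 ν) := by
    refine Integrable.of_bound (by fun_prop) 1 (ae_of_all _ fun ω => ?_)
    rw [← Complex.ofReal_mul, Complex.norm_exp_ofReal_mul_I]
  have hcomm := integral_re hint
  simp only [RCLike.re_to_complex] at hcomm
  rw [h] at hcomm
  have he : Complex.exp ((1 : ℝ) * (0 : ℝ) * Complex.I - ν * (1 : ℝ) ^ 2 / 2) =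
      ((Real.exp (-(ν / 2)) : ℝ) : ℂ) := by
    push_cast
    congr 1
    ring
  rw [he, Complex.ofReal_re] at hcomm
  rw [← hcomm]
  refine integral_congr_ae (ae_of_all _ fun x => ?_)
  simp [Complex.exp_ofReal_mul_I_re]

lemma pi_gaussianReal_eq_map (θ : ℝ) (v : ℝ≥0) (N : ℕ) :
    (Measure.pi fun _ : Fin N => gaussianReal θ v) =
      (Measure.pi fun _ : Fin N => gaussianReal 0 v).map fun ξ i => θ + ξ i := by
  have : ∀ i : Fin N, SigmaFinite ((gaussianReal 0 v).map fun x => θ + x) := by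
    intro i
    rw [gaussianReal_map_const_add]
    infer_instance
  rw [Measure.pi_map_pi (f := fun _ x => θ + x) (fun _ => by fun_prop)]
  simp [gaussianReal_map_const_add]

lemma tendsto_integral_cos_estimation_error {T : (N : ℕ) → (Fin N → ℝ) → ℝ}
    (hT : ∀ N, Measurable (T N)) {θ : ℝ} {v ν : ℝ≥0} {Q : ProbabilityMeasure ℝ}
    (hQ : (Q : Measure ℝ) = gaussianReal θ v) (h : IsAsymptoticallyNormal T Q ν) :
    Tendsto (fun N : ℕ => ∫ ξ, Real.cos (Real.sqrt N * (T N (fun i => θ + ξ i) - θ))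
      ∂Measure.pi fun _ : Fin N => gaussianReal 0 v) atTop (𝓝 (Real.exp (-(ν / 2)))) := by
  have h1 := ProbabilityMeasure.tendsto_iff_forall_integral_tendsto.1 h.tendsto
    (BoundedContinuousFunction.ofNormedAddCommGroup Real.cos Real.continuous_cos 1
      fun x => by simpa using Real.abs_cos_le_one x)
  simp only [BoundedContinuousFunction.coe_ofNormedAddCommGroup, ProbabilityMeasure.coe_mk,
    Measure.map_id', integral_cos_gaussianReal] at h1
  refine h1.congr fun N => ?_
  have hTN := hT N
  have hshift : Measurable fun (ξ : Fin N → ℝ) i => θ + ξ i := by fun_prop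
  rw [integral_map (by fun_prop) (by fun_prop), hQ, integral_id_gaussianReal,
    pi_gaussianReal_eq_map, integral_map hshift.aemeasurable (by fun_prop)]

/-- In the Gaussian location model, an estimator cannot be asymptotically normal with variance less
than `v` at every parameter. Integrate over a Gaussian prior: the mean of the cosine of the
normalised error tends to that of `exp (-ν θ / 2)`, while the Bayes bound keeps its limit below
`exp (-v / 2)`. -/
lemma variance_le_of_isAsymptoticallyNormal {T : (N : ℕ) → (Fin N → ℝ) → ℝ}
    (hT : ∀ N, Measurable (T N)) {v V : ℝ≥0} {ν : ℝ → ℝ≥0}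
    (h : ∀ θ, IsAsymptoticallyNormal T ⟨gaussianReal θ v, inferInstance⟩ (ν θ))
    (hν : ∀ θ, ν θ ≤ V) : v ≤ V := by
  rcases eq_or_ne v 0 with rfl | hv
  · exact zero_le
  let a : ℕ → ℝ → ℝ := fun N θ =>
    ∫ ξ, Real.cos (Real.sqrt N * (T N (fun i => θ + ξ i) - θ))
      ∂Measure.pi fun _ : Fin N => gaussianReal 0 v
  have hmeas : ∀ N : ℕ, Measurable fun z : ℝ × (Fin N → ℝ) =>
      Real.cos (Real.sqrt N * (T N (fun i => z.1 + z.2 i) - z.1)) := by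
    intro N
    have := hT N
    fun_prop
  have ham : ∀ N, AEStronglyMeasurable (a N) (gaussianReal 0 1) := fun N =>
    ((hmeas N).stronglyMeasurable.integral_prod_right).aestronglyMeasurable
  have hlim : Tendsto (fun N => ∫ θ, a N θ ∂gaussianReal 0 1) atTop
      (𝓝 (∫ θ, Real.exp (-(ν θ / 2)) ∂gaussianReal 0 1)) := by
    refine tendsto_integral_of_dominated_convergence (fun _ => 1) ham (integrable_const _)
      (fun N => ae_of_all _ fun θ => ?_)
      (ae_of_all _ fun θ => tendsto_integral_cos_estimation_error hT rfl (h θ))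
    refine (norm_integral_le_of_norm_le_const (C := 1) (ae_of_all _ fun ξ => ?_)).trans (by simp)
    exact Real.abs_cos_le_one _
  have hbound : ∀ N : ℕ, ∫ θ, a N θ ∂gaussianReal 0 1 ≤
      Real.exp (-((v / (v + N) : ℝ≥0) * N / 2)) := by
    intro N
    rw [← integral_prod _ (Integrable.of_bound (hmeas N).aestronglyMeasurable 1
      (ae_of_all _ fun z => Real.abs_cos_le_one _))]
    exact integral_cos_estimation_error_le v hv N (T N) (hT N)
  have hrhs : Tendsto (fun N : ℕ => Real.exp (-((v / (v + N) : ℝ≥0) * N / 2))) atTop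
      (𝓝 (Real.exp (-(v * 1 / 2)))) := by
    have h1 : Tendsto (fun N : ℕ => (N : ℝ) / (N + v)) atTop (𝓝 1) :=
      tendsto_natCast_div_add_atTop (v : ℝ)
    refine ((Real.continuous_exp.tendsto _).comp ((h1.const_mul (v : ℝ)).div_const 2).neg).congr
      fun N => ?_
    simp only [Function.comp_apply]
    congr 3
    push_cast
    rw [add_comm]
    ring
  have hup := le_of_tendsto_of_tendsto' hlim hrhs hbound
  have hνm : AEStronglyMeasurable (fun θ => Real.exp (-(ν θ / 2))) (gaussianReal 0 1) :=
    aestronglyMeasurable_of_tendsto_ae atTop ham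
      (ae_of_all _ fun θ => tendsto_integral_cos_estimation_error hT rfl (h θ))
  have hlow : Real.exp (-(V / 2)) ≤ ∫ θ, Real.exp (-(ν θ / 2)) ∂gaussianReal 0 1 := by
    have hi : Integrable (fun θ => Real.exp (-(ν θ / 2))) (gaussianReal 0 1) :=
      Integrable.of_bound hνm 1 (ae_of_all _ fun θ => by
        rw [Real.norm_of_nonneg (Real.exp_nonneg _), Real.exp_le_one_iff]
        have := (ν θ).2
        simp only [NNReal.val_eq_coe] at this
        linarith)
    have := integral_mono (integrable_const (Real.exp (-((V : ℝ) / 2)))) hi (fun θ => by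
      have : (ν θ : ℝ) ≤ V := by exact_mod_cast hν θ
      simp only
      gcongr)
    simpa using this
  have := Real.exp_le_exp.1 (hlow.trans hup)
  have : (v : ℝ) ≤ V := by linarith
  exact_mod_cast this

/-! ### The minimax asymptotic variance -/

/-- The central limit theorem for the sample mean, transferred from an infinite sequence of
observations to the finite products. -/
lemma isAsymptoticallyNormal_sampleMean {σ : ℝ≥0} {Q : ProbabilityMeasure ℝ}
    (hQ : Q ∈ finiteVarianceClass σ) :
    IsAsymptoticallyNormal (fun N x => (∑ i, x i) / N) Q (σ ^ 2) := by
  obtain ⟨hmem, hvar⟩ := hQ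
  set R : Measure ℝ := (Q : Measure ℝ) with hR
  let ρ := Measure.infinitePi fun _ : ℕ => R
  have hm : ∀ i : ℕ, AEMeasurable (fun ω : ℕ → ℝ => ω i) ρ :=
    fun i => (measurable_pi_apply i).aemeasurable
  have hlaw : ∀ i : ℕ, HasLaw (fun ω : ℕ → ℝ => ω i) R ρ := fun i =>
    ⟨(measurable_pi_apply i).aemeasurable, Measure.infinitePi_map_eval _ i⟩
  have hind : iIndepFun (fun (i : ℕ) (ω : ℕ → ℝ) => ω i) ρ :=
    iIndepFun_infinitePi (X := fun (_ : ℕ) (x : ℝ) => x) fun _ => measurable_id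
  have hv : Var[fun ω : ℕ → ℝ => ω 0; ρ] = (σ : ℝ) ^ 2 := by
    rw [(hlaw 0).variance_eq]; exact hvar
  have hclt := tendstoInDistribution_inv_sqrt_mul_sum_sub (P := ρ)
    (X := fun (i : ℕ) (ω : ℕ → ℝ) => ω i) (P' := gaussianReal 0 (σ ^ 2)) (Y := fun z => z)
    (by
      rw [hv]
      have : ((σ : ℝ) ^ 2).toNNReal = σ ^ 2 := by
        rw [← NNReal.coe_pow, Real.toNNReal_coe]
      rw [this]
      exact HasLaw.id)
    (by
      have := (hlaw 0).map_eq
      have h2 : MemLp (fun x : ℝ => x) 2 (ρ.map fun ω : ℕ → ℝ => ω 0) := by rwa [this]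
      exact h2.comp_of_map (hm 0))
    hind fun i => ⟨hm i, hm 0, by rw [(hlaw i).map_eq, (hlaw 0).map_eq]⟩
  have hmean : ∫ ω : ℕ → ℝ, ω 0 ∂ρ = ∫ y, y ∂(Q : Measure ℝ) := (hlaw 0).integral_eq
  refine ⟨fun N => by fun_prop, by fun_prop, ?_⟩
  refine hclt.tendsto.congr fun N => Subtype.ext ?_
  simp only
  have hpi : HasLaw (fun (ω : ℕ → ℝ) (i : Fin N) => ω i) (Measure.pi fun _ => R) ρ :=
    (hind.precomp (g := fun i : Fin N => (i : ℕ)) Fin.val_injective).hasLaw_pi fun i => hlaw i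
  rw [← hpi.map_eq, AEMeasurable.map_map_of_aemeasurable (by fun_prop) hpi.aemeasurable]
  congr 1
  ext ω
  simp only [Function.comp_apply, hmean]
  rw [← Fin.sum_univ_eq_sum_range]
  rcases Nat.eq_zero_or_pos N with rfl | hN
  · simp
  have hs : Real.sqrt N ^ 2 = N := Real.sq_sqrt (Nat.cast_nonneg _)
  have hN' : (0 : ℝ) < Real.sqrt N := by positivity
  generalize (∑ i : Fin N, ω i) = S
  generalize Real.sqrt N = r at hs hN'
  rw [← hs]
  field_simp

lemma gaussianReal_mem_finiteVarianceClass (θ : ℝ) (σ : ℝ≥0) :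
    (⟨gaussianReal θ (σ ^ 2), inferInstance⟩ : ProbabilityMeasure ℝ) ∈ finiteVarianceClass σ :=
  ⟨memLp_id_gaussianReal' 2 (by simp), by simp [variance_fun_id_gaussianReal]⟩

/-- The minimax asymptotic variance is `σ ^ 2`: the sample mean attains it, and the Gaussian location
model shows that it cannot be improved. -/
theorem minimaxAsymptoticVariance_eq (σ : ℝ≥0) :
    minimaxAsymptoticVariance σ = ((σ ^ 2 : ℝ≥0) : ℝ≥0∞) := by
  apply le_antisymm
  · refine iInf_le_of_le (fun N x => (∑ i, x i) / N) (iInf_le_of_le (fun _ => σ ^ 2)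
      (iInf_le_of_le (fun N => by fun_prop) (iInf_le_of_le
        (fun Q hQ => isAsymptoticallyNormal_sampleMean hQ) ?_)))
    exact iSup₂_le fun _ _ => le_rfl
  · refine le_iInf fun T => le_iInf fun ν => le_iInf fun hT => le_iInf fun hν => ?_
    refine le_of_forall_ge fun c hc => ?_
    induction c with
    | top => exact le_top
    | coe c =>
      refine ENNReal.coe_le_coe.2 (variance_le_of_isAsymptoticallyNormal hT
        (ν := fun θ => ν ⟨gaussianReal θ (σ ^ 2), inferInstance⟩)
        (fun θ => hν _ (gaussianReal_mem_finiteVarianceClass θ σ)) fun θ => ?_)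
      have := (le_iSup₂ (f := fun Q (_ : Q ∈ finiteVarianceClass σ) => (ν Q : ℝ≥0∞)) _
        (gaussianReal_mem_finiteVarianceClass θ σ)).trans hc
      exact_mod_cast this

/-! ### Moments of block means -/

lemma blockMean_add (G : Finset ℕ) (x y : ℕ → ℝ) :
    blockMean G (fun i => x i + y i) = blockMean G x + blockMean G y := by
  simp only [blockMean, Finset.sum_add_distrib, add_div]

lemma blockMean_sub (G : Finset ℕ) (x y : ℕ → ℝ) :
    blockMean G (fun i => x i - y i) = blockMean G x - blockMean G y := by
  simp only [blockMean, Finset.sum_sub_distrib, sub_div]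

lemma blockMean_const {G : Finset ℕ} (hG : G.Nonempty) (c : ℝ) :
    blockMean G (fun _ => c) = c := by
  have : (G.card : ℝ) ≠ 0 := by exact_mod_cast hG.card_ne_zero
  simp [blockMean, field]

lemma abs_blockMean_le (G : Finset ℕ) (x : ℕ → ℝ) :
    |blockMean G x| ≤ blockMean G fun i => |x i| := by
  rw [blockMean, abs_div, Nat.abs_cast]
  exact div_le_div_of_nonneg_right (Finset.abs_sum_le_sum_abs _ _) (Nat.cast_nonneg _)

section Law

variable {Ω : Type*} [MeasurableSpace Ω] {Pr : Measure Ω} {Q : Measure ℝ}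

lemma ProbabilityTheory.HasLaw.integrable_comp {Y : Ω → ℝ} (hY : HasLaw Y Q Pr) {h : ℝ → ℝ} (hh : Integrable h Q) :
    Integrable (fun ω => h (Y ω)) Pr := by
  rw [← hY.map_eq] at hh
  exact hh.comp_aemeasurable hY.aemeasurable

lemma ProbabilityTheory.HasLaw.memLp_comp {Y : Ω → ℝ} (hY : HasLaw Y Q Pr) {h : ℝ → ℝ} {q : ℝ≥0∞}
    (hh : MemLp h q Q) : MemLp (fun ω => h (Y ω)) q Pr := by
  rw [← hY.map_eq] at hh
  exact hh.comp_of_map hY.aemeasurable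

lemma ProbabilityTheory.HasLaw.integral_fun_comp {Y : Ω → ℝ} (hY : HasLaw Y Q Pr) {h : ℝ → ℝ}
    (hh : AEStronglyMeasurable h Q) : ∫ ω, h (Y ω) ∂Pr = ∫ x, h x ∂Q :=
  hY.integral_comp hh

variable {Y : ℕ → Ω → ℝ}

lemma integrable_blockMean (hlaw : ∀ i, HasLaw (Y i) Q Pr) {h : ℝ → ℝ} (hh : Integrable h Q)
    (G : Finset ℕ) : Integrable (fun ω => blockMean G fun i => h (Y i ω)) Pr :=
  (integrable_finsetSum _ fun i _ => (hlaw i).integrable_comp hh).div_const _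

lemma memLp_blockMean (hlaw : ∀ i, HasLaw (Y i) Q Pr) {h : ℝ → ℝ} {q : ℝ≥0∞} (hh : MemLp h q Q)
    (G : Finset ℕ) : MemLp (fun ω => blockMean G fun i => h (Y i ω)) q Pr := by
  have hS : MemLp (fun ω => ∑ i ∈ G, h (Y i ω)) q Pr :=
    memLp_finsetSum G fun i _ => (hlaw i).memLp_comp hh
  simpa only [blockMean, div_eq_mul_inv] using hS.mul_const ((G.card : ℝ)⁻¹)

lemma integral_blockMean (hlaw : ∀ i, HasLaw (Y i) Q Pr) {h : ℝ → ℝ} (hh : Integrable h Q)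
    {G : Finset ℕ} (hG : G.Nonempty) :
    ∫ ω, blockMean G (fun i => h (Y i ω)) ∂Pr = ∫ x, h x ∂Q := by
  have : (G.card : ℝ) ≠ 0 := by exact_mod_cast hG.card_ne_zero
  simp only [blockMean]
  rw [integral_div, integral_finsetSum _ fun i _ => (hlaw i).integrable_comp hh,
    Finset.sum_congr rfl fun i _ => (hlaw i).integral_fun_comp hh.aestronglyMeasurable]
  simp [field]

variable [IsProbabilityMeasure Pr]

lemma integral_sq_blockMean (hlaw : ∀ i, HasLaw (Y i) Q Pr) (hind : iIndepFun Y Pr)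
    {h : ℝ → ℝ} (hm : Measurable h) (hh : MemLp h 2 Q) (h0 : ∫ x, h x ∂Q = 0) (G : Finset ℕ) :
    ∫ ω, (blockMean G fun i => h (Y i ω)) ^ 2 ∂Pr = (∫ x, h x ^ 2 ∂Q) / G.card := by
  rcases G.eq_empty_or_nonempty with rfl | hG
  · simp [blockMean]
  have hc : (G.card : ℝ) ≠ 0 := by exact_mod_cast hG.card_ne_zero
  have hL : ∀ i, MemLp (fun ω => h (Y i ω)) 2 Pr := fun i => (hlaw i).memLp_comp hh
  have hmean : ∀ i, ∫ ω, h (Y i ω) ∂Pr = 0 := fun i => by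
    rw [(hlaw i).integral_fun_comp hh.aestronglyMeasurable, h0]
  have hvar := IndepFun.variance_sum (s := G) (X := fun i ω => h (Y i ω)) (fun i _ => hL i)
    fun i _ j _ hij => (hind.indepFun hij).comp hm hm
  have hS : MemLp (∑ i ∈ G, fun ω => h (Y i ω)) 2 Pr := memLp_finsetSum' _ fun i _ => hL i
  rw [variance_of_integral_eq_zero hS.aemeasurable] at hvar
  · have h1 : ∀ i, Var[fun ω => h (Y i ω); Pr] = ∫ x, h x ^ 2 ∂Q := by
      intro i
      rw [variance_of_integral_eq_zero (hL i).aemeasurable (hmean i)]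
      exact (hlaw i).integral_fun_comp (h := fun x => h x ^ 2)
        (hm.pow_const 2).aestronglyMeasurable
    simp only [h1, Finset.sum_const, nsmul_eq_mul, Finset.sum_apply] at hvar
    simp only [blockMean, div_pow]
    rw [integral_div, hvar]
    field_simp
  · simp only [Finset.sum_apply]
    rw [integral_finsetSum _ fun i _ => (hL i).integrable one_le_two]
    simp [hmean]

lemma integral_sub_integral_eq_zero [IsProbabilityMeasure Q] {h : ℝ → ℝ} (hh : Integrable h Q) :
    ∫ x, (h x - ∫ y, h y ∂Q) ∂Q = 0 := by
  rw [integral_sub hh (integrable_const _)]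
  simp

lemma integral_sq_sub_integral_le [IsProbabilityMeasure Q] {h : ℝ → ℝ} (hh : MemLp h 2 Q) :
    ∫ x, (h x - ∫ y, h y ∂Q) ^ 2 ∂Q ≤ ∫ x, h x ^ 2 ∂Q := by
  rw [← variance_eq_integral hh.aemeasurable]
  exact variance_le_expectation_sq hh.aestronglyMeasurable

/-- A weak law of large numbers in `L¹`, uniform over all blocks of large cardinality. -/
lemma exists_forall_integral_abs_blockMean_sub_le [IsProbabilityMeasure Q] (hlaw : ∀ i, HasLaw (Y i) Q Pr)
    (hind : iIndepFun Y Pr) {h : ℝ → ℝ} (hh : Integrable h Q) {ε : ℝ} (hε : 0 < ε) :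
    ∃ n₀ : ℕ, ∀ G : Finset ℕ, G.Nonempty → n₀ ≤ G.card →
      ∫ ω, |blockMean G (fun i => h (Y i ω)) - ∫ x, h x ∂Q| ∂Pr ≤ ε := by
  obtain ⟨g, hg, hgi⟩ := hh.exists_boundedContinuous_integral_sub_le (by positivity : 0 < ε / 4)
  have hgm : Measurable g := g.continuous.measurable
  have hg2 : MemLp g 2 Q := MemLp.of_bound hgi.aestronglyMeasurable ‖g‖
    (ae_of_all _ fun x => g.norm_coe_le_norm x)
  set a : ℝ → ℝ := fun x => g x - ∫ y, g y ∂Q with ha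
  have ha2 : MemLp a 2 Q := hg2.sub (memLp_const _)
  have ha0 : ∫ x, a x ∂Q = 0 := integral_sub_integral_eq_zero hgi
  set K := ∫ x, a x ^ 2 ∂Q
  have hd : Integrable (fun x => |h x - g x|) Q := (hh.sub hgi).abs
  refine ⟨⌈4 * K / ε ^ 2⌉₊, fun G hG hn => ?_⟩
  have hc : (0 : ℝ) < G.card := by exact_mod_cast hG.card_pos
  have hn' : 4 * K / ε ^ 2 ≤ G.card := (Nat.le_ceil _).trans (by exact_mod_cast hn)
  have hpt : ∀ ω, |blockMean G (fun i => h (Y i ω)) - ∫ x, h x ∂Q| ≤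
      ((blockMean G fun i => a (Y i ω)) ^ 2 / ε + ε / 4) +
        ((blockMean G fun i => |h (Y i ω) - g (Y i ω)|) + ε / 4) := by
    intro ω
    have e1 : blockMean G (fun i => h (Y i ω)) - ∫ x, h x ∂Q =
        (blockMean G fun i => a (Y i ω)) + ((blockMean G fun i => h (Y i ω) - g (Y i ω)) +
          ∫ x, (g x - h x) ∂Q) := by
      simp only [ha]
      rw [blockMean_sub, blockMean_sub, blockMean_const hG, integral_sub hgi hh]
      ring
    have e2 : |∫ x, (g x - h x) ∂Q| ≤ ε / 4 := by
      refine (abs_integral_le_integral_abs).trans ?_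
      simpa only [Real.norm_eq_abs, abs_sub_comm] using hg
    have e3 : ∀ t : ℝ, |t| ≤ t ^ 2 / ε + ε / 4 := by
      intro t
      have : 0 ≤ (|t| - ε / 2) ^ 2 / ε := by positivity
      have h2 : (|t| - ε / 2) ^ 2 / ε = t ^ 2 / ε + ε / 4 - |t| := by
        rw [sub_sq, sq_abs]
        field_simp
        ring
      linarith
    rw [e1]
    refine (abs_add_le _ _).trans (add_le_add (e3 _) ((abs_add_le _ _).trans
      (add_le_add (abs_blockMean_le _ _) e2)))
  have hi1 : Integrable (fun ω => (blockMean G fun i => a (Y i ω)) ^ 2) Pr :=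
    (memLp_blockMean hlaw ha2 G).integrable_sq
  have hi2 : Integrable (fun ω => blockMean G fun i => |h (Y i ω) - g (Y i ω)|) Pr :=
    integrable_blockMean hlaw hd G
  have hi3 : Integrable (fun ω => (blockMean G fun i => a (Y i ω)) ^ 2 / ε + ε / 4) Pr :=
    (hi1.div_const _).add (integrable_const _)
  have hi4 : Integrable (fun ω => (blockMean G fun i => |h (Y i ω) - g (Y i ω)|) + ε / 4) Pr :=
    hi2.add (integrable_const _)
  have hle := integral_mono
    ((integrable_blockMean hlaw hh G).sub (integrable_const (∫ x, h x ∂Q))).abs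
    (hi3.add hi4) hpt
  refine hle.trans ?_
  simp only [Pi.add_apply]
  rw [integral_add hi3 hi4, integral_add (hi1.div_const _) (integrable_const _),
    integral_add hi2 (integrable_const _), integral_div,
    integral_sq_blockMean hlaw hind (hgm.sub_const _) ha2 ha0,
    integral_blockMean hlaw (h := fun x => |h x - g x|) hd hG]
  have e4 : K / G.card / ε ≤ ε / 4 := by
    rw [div_le_iff₀ (by positivity)] at hn' 
    rw [div_div, div_le_iff₀ (by positivity)]
    linarith
  simp only [Real.norm_eq_abs] at hg
  simp only [integral_const, probReal_univ, one_smul]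
  change K / G.card / ε + ε / 4 + (∫ x, |h x - g x| ∂Q + ε / 4) ≤ ε
  linarith

/-- Normalised sums of bounded centred variables have bounded fourth moments, since they are
sub-Gaussian with a parameter that does not depend on the block (Hoeffding's lemma). -/
lemma exists_integral_blockMean_pow_four_le (hlaw : ∀ i, HasLaw (Y i) Q Pr)
    (hind : iIndepFun Y Pr) {h : ℝ → ℝ} (hm : Measurable h) {A : ℝ} (hA : ∀ x, |h x| ≤ A)
    (h0 : ∫ x, h x ∂Q = 0) :
    ∃ B : ℝ, 0 < B ∧ ∀ G : Finset ℕ, G.Nonempty →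
      Integrable (fun ω => (Real.sqrt G.card * blockMean G fun i => h (Y i ω)) ^ 4) Pr ∧
      ∫ ω, (Real.sqrt G.card * blockMean G fun i => h (Y i ω)) ^ 4 ∂Pr ≤ B := by
  set c : ℝ≥0 := (‖A - -A‖₊ / 2) ^ 2
  refine ⟨48 * Real.exp (c / 2), by positivity, fun G hG => ?_⟩
  have hc : (0 : ℝ) < G.card := by exact_mod_cast hG.card_pos
  have hsub : ∀ i, HasSubgaussianMGF (fun ω => h (Y i ω)) c Pr := fun i =>
    hasSubgaussianMGF_of_mem_Icc_of_integral_eq_zero (hm.comp_aemeasurable (hlaw i).aemeasurable)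
      (ae_of_all _ fun ω => abs_le.1 (hA _))
      (by rw [(hlaw i).integral_fun_comp hm.aestronglyMeasurable, h0])
  have hsum := HasSubgaussianMGF.sum_of_iIndepFun (hind.comp (fun _ => h) fun _ => hm)
    (s := G) (c := fun _ => c) fun i _ => hsub i
  have hT := hsum.const_mul (1 / Real.sqrt G.card)
  set T : Ω → ℝ := fun ω => Real.sqrt G.card * blockMean G fun i => h (Y i ω)
  have hTeq : (fun ω => 1 / Real.sqrt G.card * ∑ i ∈ G, (h ∘ Y i) ω) = T := by
    ext ω
    have hs : Real.sqrt G.card ^ 2 = G.card := Real.sq_sqrt hc.le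
    have hs' : 0 < Real.sqrt G.card := by positivity
    simp only [T, blockMean, Function.comp_apply]
    generalize Real.sqrt (G.card : ℝ) = r at hs hs'
    rw [← hs]
    field_simp
  have hparam : ((1 / Real.sqrt G.card) ^ 2 * (G.card * c) : ℝ) = c := by
    rw [div_pow, Real.sq_sqrt hc.le]
    field_simp
  have hexp : ∀ t : ℝ, Integrable (fun ω => Real.exp (t * T ω)) Pr ∧
      ∫ ω, Real.exp (t * T ω) ∂Pr ≤ Real.exp (c * t ^ 2 / 2) := by
    intro t
    rw [← hTeq]
    refine ⟨hT.integrable_exp_mul t, (hT.mgf_le t).trans (le_of_eq ?_)⟩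
    congr 3
    simp only [Finset.sum_const, nsmul_eq_mul]
    exact hparam
  have hpt : ∀ ω, T ω ^ 4 ≤ 24 * (Real.exp (1 * T ω) + Real.exp (-1 * T ω)) := by
    intro ω
    have h1 := Real.pow_div_factorial_le_exp |T ω| (abs_nonneg _) 4
    have h2 : Real.exp |T ω| ≤ Real.exp (1 * T ω) + Real.exp (-1 * T ω) := by
      rw [one_mul, neg_one_mul]
      rcases abs_cases (T ω) with ⟨h, _⟩ | ⟨h, _⟩ <;> rw [h]
      · linarith [Real.exp_pos (-T ω)]
      · linarith [Real.exp_pos (T ω)]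
    rw [show |T ω| ^ 4 = T ω ^ 4 from (show Even 4 by decide).pow_abs _] at h1
    norm_num [Nat.factorial] at h1
    simp only [one_mul, neg_mul] at h2 ⊢
    linarith
  have hTm : AEStronglyMeasurable T Pr := by
    rw [← hTeq]
    exact hT.aestronglyMeasurable
  have hib := (((hexp 1).1.add (hexp (-1)).1).const_mul 24)
  refine ⟨hib.mono' (hTm.pow 4) (ae_of_all _ fun ω => ?_), ?_⟩
  · rw [Real.norm_of_nonneg (by positivity)]
    exact hpt ω
  · refine (integral_mono_of_nonneg (ae_of_all _ fun ω => by positivity) hib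
      (ae_of_all _ hpt)).trans ?_
    simp only [Pi.add_apply]
    rw [integral_const_mul, integral_add (hexp 1).1 (hexp (-1)).1]
    have h1 := (hexp 1).2
    have h2 := (hexp (-1)).2
    norm_num at h1 h2 ⊢
    linarith

end Law

/-! ### Block variances and uniform integrability -/

/-- Sample variance (normalised by `|G|`) of the observations `x i`, `i ∈ G`, written as the mean of
the squares minus the square of the mean. -/
noncomputable def blockVar (G : Finset ℕ) (x : ℕ → ℝ) : ℝ :=
  blockMean G (fun i => x i ^ 2) - blockMean G x ^ 2

lemma blockStd_eq_sqrt_blockVar {G : Finset ℕ} (hG : G.Nonempty) (x : ℕ → ℝ) :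
    blockStd G x = Real.sqrt (blockVar G x) := by
  have hc : (G.card : ℝ) ≠ 0 := by exact_mod_cast hG.card_ne_zero
  have hS : ∑ i ∈ G, x i = G.card * blockMean G x := by
    rw [blockMean]
    field_simp
  rw [blockStd, blockVar]
  congr 1
  simp_rw [sub_sq]
  rw [Finset.sum_add_distrib, Finset.sum_sub_distrib, ← Finset.sum_mul, ← Finset.mul_sum, hS]
  simp only [blockMean, Finset.sum_const, nsmul_eq_mul]
  field_simp
  ring

section Law

variable {Ω : Type*} [MeasurableSpace Ω] {Pr : Measure Ω} [IsProbabilityMeasure Pr]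
  {Q : Measure ℝ} [IsProbabilityMeasure Q] {Y : ℕ → Ω → ℝ}

/-- Uniform integrability of `|G| * (blockMean G Y)²` over all blocks: its product with the square of
a bounded variable `H` is small in mean as soon as `H` is small in `L¹`. The observations are split
into a bounded centred part, handled by its fourth moments, and a part of small variance. -/
lemma exists_forall_integral_sq_mul_blockMean_le (hlaw : ∀ i, HasLaw (Y i) Q Pr)
    (hind : iIndepFun Y Pr) (hQ : MemLp (fun x : ℝ => x) 2 Q) (h0 : ∫ x, x ∂Q = 0)
    {K : ℝ} (hK : 0 < K) {ε : ℝ} (hε : 0 < ε) :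
    ∃ η > 0, ∀ (G : Finset ℕ) (H : Ω → ℝ), G.Nonempty → AEStronglyMeasurable H Pr →
      (∀ ω, |H ω| ≤ K) → ∫ ω, |H ω| ∂Pr ≤ η →
      G.card * ∫ ω, (H ω * blockMean G fun i => Y i ω) ^ 2 ∂Pr ≤ ε := by
  obtain ⟨g, hg, hgi⟩ := (show MemLp (fun x : ℝ => x) (ENNReal.ofReal 2) Q by
    simpa using hQ).exists_boundedContinuous_integral_rpow_sub_le two_pos
    (by positivity : 0 < ε / (6 * K ^ 2))
  have hgm : Measurable g := g.continuous.measurable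
  have hg2 : MemLp g 2 Q := by simpa using hgi
  set a : ℝ → ℝ := fun x => g x - ∫ y, g y ∂Q with ha
  have ham : Measurable a := hgm.sub_const _
  have ha2 : MemLp a 2 Q := hg2.sub (memLp_const _)
  have ha0 : ∫ x, a x ∂Q = 0 := integral_sub_integral_eq_zero (hg2.integrable one_le_two)
  have hab : ∀ x, |a x| ≤ 2 * ‖g‖ := by
    intro x
    refine (abs_sub _ _).trans ?_
    have h1 : |g x| ≤ ‖g‖ := g.norm_coe_le_norm x
    have h2 : |∫ y, g y ∂Q| ≤ ‖g‖ := by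
      have := norm_integral_le_of_norm_le_const (μ := Q) (f := g) (C := ‖g‖)
        (ae_of_all _ fun x => g.norm_coe_le_norm x)
      simpa using this
    linarith
  set b : ℝ → ℝ := fun x => x - a x with hb
  have hbm : Measurable b := measurable_id.sub ham
  have hb2 : MemLp b 2 Q := hQ.sub ha2
  have hb0 : ∫ x, b x ∂Q = 0 := by
    simp only [hb]
    rw [integral_sub (hQ.integrable one_le_two) (ha2.integrable one_le_two), h0, ha0, sub_zero]
  have hbε : ∫ x, b x ^ 2 ∂Q ≤ ε / (6 * K ^ 2) := by
    have h1 := integral_sq_sub_integral_le (Q := Q) (hQ.sub hg2)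
    simp only [Pi.sub_apply] at h1
    rw [integral_sub (hQ.integrable one_le_two) (hg2.integrable one_le_two), h0] at h1
    simp only [Real.norm_eq_abs, Real.rpow_two, sq_abs] at hg
    refine le_trans (le_of_eq ?_) (h1.trans hg)
    congr 1
    ext x
    simp only [hb, ha]
    ring
  obtain ⟨B, hB, hB4⟩ := exists_integral_blockMean_pow_four_le hlaw hind ham hab ha0
  -- weight in `2 H² T² ≤ H⁴ / l + l T⁴`, small enough for the fourth moment to cost only `ε / 3`
  set l := ε / (3 * B) with hl
  have hl0 : 0 < l := by positivity
  refine ⟨l * ε / (3 * K ^ 3), by positivity, fun G H hG hH hHK hHη => ?_⟩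
  have hc : (0 : ℝ) < G.card := by exact_mod_cast hG.card_pos
  have hs : Real.sqrt G.card ^ 2 = G.card := Real.sq_sqrt hc.le
  obtain ⟨hi4, hB4⟩ := hB4 G hG
  have hpt : ∀ ω, G.card * (H ω * blockMean G fun i => Y i ω) ^ 2 ≤
      (K ^ 3 / l * |H ω| + l * (Real.sqrt G.card * blockMean G fun i => a (Y i ω)) ^ 4) +
        2 * K ^ 2 * G.card * (blockMean G fun i => b (Y i ω)) ^ 2 := by
    intro ω
    have e1 : (blockMean G fun i => Y i ω) =
        (blockMean G fun i => a (Y i ω)) + blockMean G fun i => b (Y i ω) := by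
      rw [← blockMean_add]
      simp [hb]
    rw [e1]
    set s := blockMean G fun i => a (Y i ω)
    set t := blockMean G fun i => b (Y i ω)
    have hH0 := abs_nonneg (H ω)
    have hHK' := hHK ω
    have hH2 : H ω ^ 2 ≤ K ^ 2 := sq_le_sq' (by linarith [neg_abs_le (H ω)])
      ((le_abs_self _).trans hHK')
    have hH4 : H ω ^ 4 ≤ K ^ 3 * |H ω| := by
      rw [← (show Even 4 by decide).pow_abs, pow_succ]
      gcongr
    have e2 : G.card * (H ω * (s + t)) ^ 2 ≤
        2 * (H ω ^ 2 * (Real.sqrt G.card * s) ^ 2) + 2 * K ^ 2 * G.card * t ^ 2 := by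
      rw [mul_pow (Real.sqrt _), hs]
      have e4 : (s + t) ^ 2 ≤ 2 * s ^ 2 + 2 * t ^ 2 := by nlinarith [sq_nonneg (s - t)]
      have e5 : G.card * (H ω * (s + t)) ^ 2 ≤ G.card * (H ω ^ 2 * (2 * s ^ 2 + 2 * t ^ 2)) := by
        rw [mul_pow]
        gcongr
      have e6 : H ω ^ 2 * (G.card * t ^ 2) ≤ K ^ 2 * (G.card * t ^ 2) := by gcongr
      nlinarith
    have e3 : 2 * (H ω ^ 2 * (Real.sqrt G.card * s) ^ 2) ≤
        K ^ 3 / l * |H ω| + l * (Real.sqrt G.card * s) ^ 4 := by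
      have h1 : 0 ≤ (H ω ^ 2 - l * (Real.sqrt G.card * s) ^ 2) ^ 2 / l := by positivity
      have h2 : (H ω ^ 2 - l * (Real.sqrt G.card * s) ^ 2) ^ 2 / l =
          H ω ^ 4 / l + l * (Real.sqrt G.card * s) ^ 4 -
            2 * (H ω ^ 2 * (Real.sqrt G.card * s) ^ 2) := by
        field_simp
        ring
      have h3 : H ω ^ 4 / l ≤ K ^ 3 / l * |H ω| := by
        rw [div_mul_eq_mul_div]
        gcongr
      linarith
    linarith
  have hHi : Integrable (fun ω => |H ω|) Pr :=
    (Integrable.of_bound hH K (ae_of_all _ hHK)).abs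
  have hbi : Integrable (fun ω => (blockMean G fun i => b (Y i ω)) ^ 2) Pr :=
    (memLp_blockMean hlaw hb2 G).integrable_sq
  have hi1 : Integrable (fun ω => K ^ 3 / l * |H ω| +
      l * (Real.sqrt G.card * blockMean G fun i => a (Y i ω)) ^ 4) Pr :=
    (hHi.const_mul (K ^ 3 / l)).add (hi4.const_mul l)
  have hi2 := hbi.const_mul (2 * K ^ 2 * G.card)
  rw [← integral_const_mul]
  refine (integral_mono_of_nonneg (ae_of_all _ fun ω => by positivity) (hi1.add hi2)
    (ae_of_all _ hpt)).trans ?_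
  simp only [Pi.add_apply]
  rw [integral_add hi1 hi2, integral_add (hHi.const_mul _) (hi4.const_mul _), integral_const_mul,
    integral_const_mul, integral_const_mul, integral_sq_blockMean hlaw hind hbm hb2 hb0]
  have f1 : K ^ 3 / l * ∫ ω, |H ω| ∂Pr ≤ ε / 3 := by
    refine (mul_le_mul_of_nonneg_left hHη (by positivity)).trans (le_of_eq ?_)
    field_simp
  have f2 : l * ∫ ω, (Real.sqrt G.card * blockMean G fun i => a (Y i ω)) ^ 4 ∂Pr ≤ ε / 3 := by
    refine (mul_le_mul_of_nonneg_left hB4 hl0.le).trans (le_of_eq ?_)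
    rw [hl]
    field_simp
  have f3 : 2 * K ^ 2 * G.card * ((∫ x, b x ^ 2 ∂Q) / G.card) ≤ ε / 3 := by
    have : 2 * K ^ 2 * G.card * ((∫ x, b x ^ 2 ∂Q) / G.card) = 2 * K ^ 2 * ∫ x, b x ^ 2 ∂Q := by
      field_simp
    rw [this]
    refine (mul_le_mul_of_nonneg_left hbε (by positivity)).trans (le_of_eq ?_)
    field_simp
    norm_num
  linarith

/-- A block variance falls below a quarter of the true variance with probability `O(1 / |G|)`.
Chebyshev's inequality for truncated squares suffices, since truncation only decreases the mean
of squares. -/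
lemma exists_measureReal_blockVar_lt_le (hlaw : ∀ i, HasLaw (Y i) Q Pr)
    (hind : iIndepFun Y Pr) (hQ : MemLp (fun x : ℝ => x) 2 Q) (h0 : ∫ x, x ∂Q = 0)
    {v : ℝ} (hv : ∫ x, x ^ 2 ∂Q = v) (hv0 : 0 < v) :
    ∃ C : ℝ, ∀ G : Finset ℕ, G.Nonempty →
      Pr.real {ω | blockVar G (fun i => Y i ω) < v / 4} ≤ C / G.card := by
  have hsq : Integrable (fun x : ℝ => x ^ 2) Q := hQ.integrable_sq
  obtain ⟨M, hM⟩ : ∃ M : ℕ, 3 * v / 4 < ∫ x, min (x ^ 2) (M : ℝ) ∂Q := by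
    have hlim : Tendsto (fun M : ℕ => ∫ x, min (x ^ 2) (M : ℝ) ∂Q) atTop (𝓝 v) := by
      rw [← hv]
      refine tendsto_integral_of_dominated_convergence (fun x => x ^ 2)
        (fun M => by fun_prop) hsq (fun M => ae_of_all _ fun x => ?_) (ae_of_all _ fun x => ?_)
      · rw [Real.norm_of_nonneg (by positivity)]
        exact min_le_left _ _
      · refine tendsto_const_nhds.congr' ?_
        filter_upwards [eventually_ge_atTop ⌈x ^ 2⌉₊] with M hM
        rw [min_eq_left]
        exact (Nat.le_ceil _).trans (by exact_mod_cast hM)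
    exact (hlim.eventually_const_lt (by linarith)).exists
  set z : ℝ → ℝ := fun x => min (x ^ 2) (M : ℝ)
  have hzm : Measurable z := by fun_prop
  have hz2 : MemLp z 2 Q := MemLp.of_bound hzm.aestronglyMeasurable (M : ℝ)
    (ae_of_all _ fun x => by
      rw [Real.norm_of_nonneg (by positivity)]
      exact min_le_right _ _)
  set a : ℝ → ℝ := fun x => z x - ∫ y, z y ∂Q with ha
  have ham : Measurable a := hzm.sub_const _
  have ha2 : MemLp a 2 Q := hz2.sub (memLp_const _)
  have ha0 : ∫ x, a x ∂Q = 0 := integral_sub_integral_eq_zero (hz2.integrable one_le_two)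
  refine ⟨(∫ x, a x ^ 2 ∂Q) / (v / 4) ^ 2 + v / (v / 4), fun G hG => ?_⟩
  have hsub : {ω | blockVar G (fun i => Y i ω) < v / 4} ⊆
      {ω | (v / 4) ^ 2 ≤ (blockMean G fun i => a (Y i ω)) ^ 2} ∪
        {ω | v / 4 ≤ (blockMean G fun i => Y i ω) ^ 2} := by
    intro ω hω
    simp only [Set.mem_union, Set.mem_ofPred_eq] at hω ⊢
    by_contra! hcon
    have h1 : (blockMean G fun i => z (Y i ω)) ≤ blockMean G fun i => Y i ω ^ 2 := by
      unfold blockMean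
      gcongr
      exact min_le_left _ _
    have h2 := (abs_lt.1 (sq_lt_sq.1 hcon.1)).1
    rw [abs_of_pos (by positivity)] at h2
    simp only [ha] at h2
    rw [blockMean_sub, blockMean_const hG] at h2
    rw [blockVar] at hω
    linarith [hcon.2]
  refine (measureReal_mono hsub).trans ((measureReal_union_le _ _).trans ?_)
  rw [add_div]
  gcongr
  · have := mul_meas_ge_le_integral_of_nonneg (μ := Pr)
      (ae_of_all _ fun ω => sq_nonneg (blockMean G fun i => a (Y i ω)))
      (memLp_blockMean hlaw ha2 G).integrable_sq ((v / 4) ^ 2)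
    rw [integral_sq_blockMean hlaw hind ham ha2 ha0] at this
    rw [div_right_comm, le_div_iff₀ (by positivity), mul_comm]
    exact this
  · have := mul_meas_ge_le_integral_of_nonneg (μ := Pr)
      (ae_of_all _ fun ω => sq_nonneg (blockMean G fun i => Y i ω))
      (memLp_blockMean hlaw (h := fun x => x) hQ G).integrable_sq (v / 4)
    rw [integral_sq_blockMean hlaw hind (h := fun x => x) measurable_id hQ h0, hv] at this
    rw [div_right_comm, le_div_iff₀ (by positivity), mul_comm]
    exact this

end Law

/-! ### The bias of a weighted block mean -/

section Bias

variable {Ω : Type*} [MeasurableSpace Ω] {Pr : Measure Ω}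
  {Q : Measure ℝ} {Y : ℕ → Ω → ℝ}

lemma measurable_blockMean (hY : ∀ i, Measurable (Y i)) (G : Finset ℕ) :
    Measurable fun ω => blockMean G fun i => Y i ω := by
  unfold blockMean
  fun_prop

lemma measurable_blockVar (hY : ∀ i, Measurable (Y i)) (G : Finset ℕ) :
    Measurable fun ω => blockVar G fun i => Y i ω :=
  (measurable_blockMean (Y := fun i ω => Y i ω ^ 2) (fun i => (hY i).pow_const 2) G).sub
    ((measurable_blockMean hY G).pow_const 2)

/-- Leave-one-out bound for the correlation between an observation and a function of the block
variance. Dropping the observation `Y l` from the block makes the two independent, and changes the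
block variance by at most `(Y l)² / n + 2 |B| |Y l| / n`, where `n B` is the sum of the others. As `f`
is bounded as well as Lipschitz, only the truncated quantity `min (2 * K) (L * (x ^ 2 / n))`
enters. -/
lemma abs_integral_mul_comp_blockVar_le (hY : ∀ i, Measurable (Y i))
    (hlaw : ∀ i, HasLaw (Y i) Q Pr) (hind : iIndepFun Y Pr)
    [IsProbabilityMeasure Pr] [IsFiniteMeasure Q] (hQ : MemLp (fun x : ℝ => x) 2 Q) (h0 : ∫ x, x ∂Q = 0)
    {f : ℝ → ℝ} (hf : Continuous f) {K L : ℝ} (hK : ∀ x, |f x| ≤ K)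
    (hL : ∀ x y, |f x - f y| ≤ L * |x - y|) {G : Finset ℕ} {l : ℕ} (hl : l ∈ G) :
    |∫ ω, Y l ω * f (blockVar G fun i => Y i ω) ∂Pr| ≤
      ∫ x, |x| * min (2 * K) (L * (x ^ 2 / G.card)) ∂Q +
        2 * L * (∫ x, x ^ 2 ∂Q) * (∫ x, |x| ∂Q) / G.card := by
  have hcN : 0 < G.card := Finset.card_pos.2 ⟨l, hl⟩
  have hc1 : (1 : ℝ) ≤ G.card := by exact_mod_cast hcN
  have hc : (0 : ℝ) < G.card := by exact_mod_cast hcN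
  have hL0 : 0 ≤ L := by
    have := (abs_nonneg _).trans (hL 1 0)
    simpa using this
  have hK0 : 0 ≤ K := (abs_nonneg _).trans (hK 0)
  set n : ℝ := (G.card : ℝ)
  set E := G.erase l with hE
  set A : Ω → ℝ := fun ω => (∑ i ∈ E, Y i ω ^ 2) / n with hA
  set B : Ω → ℝ := fun ω => (∑ i ∈ E, Y i ω) / n with hB
  have hAm : Measurable A := by fun_prop
  have hBm : Measurable B := by fun_prop
  have hpair : IndepFun (Y l) (fun ω => (A ω, B ω)) Pr := by
    have h1 := hind.indepFun_finset {l} E (by simp [hE]) hY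
    have hφ : Measurable fun y : ({l} : Finset ℕ) → ℝ => y ⟨l, Finset.mem_singleton_self l⟩ :=
      measurable_pi_apply _
    have hψ : Measurable fun y : E → ℝ => ((∑ i, y i ^ 2) / n, (∑ i, y i) / n) := by fun_prop
    have h2 := h1.comp hφ hψ
    have hAB : (fun ω => (A ω, B ω)) = (fun y : E → ℝ => ((∑ i, y i ^ 2) / n, (∑ i, y i) / n)) ∘
        fun ω (i : E) => Y i ω := by
      ext ω : 1
      simp only [Function.comp_apply, A, B]
      rw [Finset.sum_coe_sort E fun i => Y i ω ^ 2, Finset.sum_coe_sort E fun i => Y i ω]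
    rw [hAB]
    exact h2
  have hY2 : MemLp (Y l) 2 Pr := (hlaw l).memLp_comp hQ
  have hY1 : Integrable (Y l) Pr := hY2.integrable one_le_two
  have hYsq : Integrable (fun ω => Y l ω ^ 2) Pr := hY2.integrable_sq
  have hQ1 : Integrable (fun x : ℝ => |x|) Q := (hQ.integrable one_le_two).abs
  -- the part of the variance that does not involve the observation `l`
  set U : Ω → ℝ := fun ω => A ω - B ω ^ 2 with hU
  have hUm : Measurable U := by fun_prop
  have hdecomp : ∀ ω, blockVar G (fun i => Y i ω) =
      U ω + (Y l ω ^ 2 / n - (Y l ω / n) ^ 2 - 2 * B ω * (Y l ω / n)) := by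
    intro ω
    simp only [blockVar, blockMean, hU, hA, hB]
    rw [← Finset.add_sum_erase G (fun i => Y i ω ^ 2) hl,
      ← Finset.add_sum_erase G (fun i => Y i ω) hl]
    ring
  have hindU : ∫ ω, Y l ω * f (U ω) ∂Pr = 0 := by
    have h1 : IndepFun (Y l) (fun ω => f (U ω)) Pr :=
      hpair.comp (φ := fun y => y) (ψ := fun q : ℝ × ℝ => f (q.1 - q.2 ^ 2)) measurable_id
        (by fun_prop)
    rw [h1.integral_fun_mul_eq_mul_integral (hY l).aestronglyMeasurable (by fun_prop),
      (hlaw l).integral_eq, h0, zero_mul]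
  have hindB : IndepFun (fun ω => Y l ω ^ 2) (fun ω => |B ω|) Pr :=
    hpair.comp (φ := fun y => y ^ 2) (ψ := fun q : ℝ × ℝ => |q.2|) (by fun_prop)
      (by fun_prop)
  have hBi : Integrable (fun ω => |B ω|) Pr :=
    ((integrable_finsetSum _ fun i _ =>
      (hlaw i).integrable_comp (h := fun x => x) (hQ.integrable one_le_two)).div_const _).abs
  have hBle : ∫ ω, |B ω| ∂Pr ≤ ∫ x, |x| ∂Q := by
    have hsum : Integrable (fun ω => (∑ i ∈ E, |Y i ω|) / n) Pr :=
      (integrable_finsetSum _ fun i _ => (hlaw i).integrable_comp (h := fun x => |x|)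
        hQ1).div_const _
    have h1 : ∫ ω, |B ω| ∂Pr ≤ ∫ ω, (∑ i ∈ E, |Y i ω|) / n ∂Pr := by
      refine integral_mono hBi hsum fun ω => ?_
      simp only [hB]
      rw [abs_div, abs_of_pos hc]
      gcongr
      exact Finset.abs_sum_le_sum_abs _ _
    refine h1.trans ?_
    rw [integral_div, integral_finsetSum _ fun i _ => (hlaw i).integrable_comp
      (h := fun x => |x|) hQ1, Finset.sum_congr rfl fun i _ => (hlaw i).integral_fun_comp
      (h := fun x => |x|) hQ1.aestronglyMeasurable]
    have hE' : (E.card : ℝ) ≤ n := by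
      exact Nat.cast_le.2 <| Finset.card_le_card (Finset.erase_subset l G)
    have h2 : 0 ≤ ∫ x, |x| ∂Q := integral_nonneg fun x => abs_nonneg x
    rw [Finset.sum_const, nsmul_eq_mul, div_le_iff₀ hc, mul_comm]
    gcongr
  have hVm : Measurable fun ω => f (blockVar G fun i => Y i ω) :=
    hf.measurable.comp (measurable_blockVar hY G)
  have hi1 : Integrable (fun ω => Y l ω * f (blockVar G fun i => Y i ω)) Pr :=
    hY1.mul_bdd hVm.aestronglyMeasurable (c := K) (ae_of_all _ fun ω => hK _)
  have hi2 : Integrable (fun ω => Y l ω * f (U ω)) Pr :=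
    hY1.mul_bdd (by fun_prop) (c := K) (ae_of_all _ fun ω => hK _)
  have hi3 : Integrable (fun x : ℝ => |x| * min (2 * K) (L * (x ^ 2 / n))) Q := by
    refine hQ1.mul_bdd (by fun_prop) (c := 2 * K) (ae_of_all _ fun x => ?_)
    rw [Real.norm_of_nonneg (by positivity)]
    exact min_le_left _ _
  have hi3' : Integrable (fun ω => |Y l ω| * min (2 * K) (L * (Y l ω ^ 2 / n))) Pr :=
    (hlaw l).integrable_comp hi3
  have hi4 : Integrable (fun ω => 2 * L / n * (Y l ω ^ 2 * |B ω|)) Pr :=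
    (hindB.integrable_mul hYsq hBi).const_mul _
  have hpt : ∀ ω, |Y l ω * f (blockVar G fun i => Y i ω) - Y l ω * f (U ω)| ≤
      |Y l ω| * min (2 * K) (L * (Y l ω ^ 2 / n)) + 2 * L / n * (Y l ω ^ 2 * |B ω|) := by
    intro ω
    rw [← mul_sub, abs_mul, hdecomp ω]
    set y := Y l ω
    set D := y ^ 2 / n - (y / n) ^ 2 - 2 * B ω * (y / n)
    have h1 : |f (U ω + D) - f (U ω)| ≤ 2 * K :=
      (abs_sub _ _).trans (by linarith [hK (U ω + D), hK (U ω)])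
    have h2 : |f (U ω + D) - f (U ω)| ≤ L * (y ^ 2 / n) + 2 * L / n * (|y| * |B ω|) := by
      have h3 := hL (U ω + D) (U ω)
      rw [add_sub_cancel_left] at h3
      refine h3.trans ?_
      have h4 : 0 ≤ y ^ 2 / n - (y / n) ^ 2 := by
        rw [div_pow, sub_nonneg]
        gcongr
        exact le_self_pow₀ hc1 two_ne_zero
      have h5 : |D| ≤ y ^ 2 / n + 2 / n * (|y| * |B ω|) := by
        refine (abs_sub _ _).trans ?_
        rw [abs_of_nonneg h4, abs_mul, abs_mul, abs_div y, abs_of_pos hc, abs_two]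
        have h6 : 0 ≤ (y / n) ^ 2 := by positivity
        have h7 : 2 * |B ω| * (|y| / n) = 2 / n * (|y| * |B ω|) := by ring
        linarith
      calc L * |D| ≤ L * (y ^ 2 / n + 2 / n * (|y| * |B ω|)) := by gcongr
        _ = _ := by ring
    have h3 : |f (U ω + D) - f (U ω)| ≤
        min (2 * K) (L * (y ^ 2 / n)) + 2 * L / n * (|y| * |B ω|) := by
      have h4 : 0 ≤ 2 * L / n * (|y| * |B ω|) := by positivity
      rw [← min_add_add_right]
      exact le_min (by linarith) h2
    refine (mul_le_mul_of_nonneg_left h3 (abs_nonneg y)).trans (le_of_eq ?_)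
    rw [← sq_abs y]
    ring
  have hkey : ∫ ω, Y l ω * f (blockVar G fun i => Y i ω) ∂Pr =
      ∫ ω, (Y l ω * f (blockVar G fun i => Y i ω) - Y l ω * f (U ω)) ∂Pr := by
    rw [integral_sub hi1 hi2, hindU, sub_zero]
  rw [hkey]
  refine abs_integral_le_integral_abs.trans ((integral_mono (hi1.sub hi2).abs (hi3'.add hi4)
    hpt).trans ?_)
  simp only [Pi.add_apply]
  rw [integral_add hi3' hi4, (hlaw l).integral_fun_comp
    (h := fun x => |x| * min (2 * K) (L * (x ^ 2 / n))) hi3.aestronglyMeasurable,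
    integral_const_mul, hindB.integral_fun_mul_eq_mul_integral hYsq.aestronglyMeasurable
      hBi.aestronglyMeasurable,
    (hlaw l).integral_fun_comp (h := fun x => x ^ 2) (by fun_prop)]
  gcongr
  have h2 : 0 ≤ ∫ x, x ^ 2 ∂Q := integral_nonneg fun x => sq_nonneg x
  calc 2 * L / n * ((∫ x, x ^ 2 ∂Q) * ∫ ω, |B ω| ∂Pr)
      ≤ 2 * L / n * ((∫ x, x ^ 2 ∂Q) * ∫ x, |x| ∂Q) := by gcongr
    _ = _ := by ring

lemma abs_integral_comp_blockVar_mul_blockMean_le (hY : ∀ i, Measurable (Y i))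
    (hlaw : ∀ i, HasLaw (Y i) Q Pr) (hind : iIndepFun Y Pr)
    [IsProbabilityMeasure Pr] [IsFiniteMeasure Q] (hQ : MemLp (fun x : ℝ => x) 2 Q) (h0 : ∫ x, x ∂Q = 0)
    {f : ℝ → ℝ} (hf : Continuous f) {K L : ℝ} (hK : ∀ x, |f x| ≤ K)
    (hL : ∀ x y, |f x - f y| ≤ L * |x - y|) {G : Finset ℕ} (hG : G.Nonempty) :
    |∫ ω, f (blockVar G fun i => Y i ω) * blockMean G (fun i => Y i ω) ∂Pr| ≤
      ∫ x, |x| * min (2 * K) (L * (x ^ 2 / G.card)) ∂Q +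
        2 * L * (∫ x, x ^ 2 ∂Q) * (∫ x, |x| ∂Q) / G.card := by
  have hc : (0 : ℝ) < G.card := by exact_mod_cast hG.card_pos
  have hVm : Measurable fun ω => f (blockVar G fun i => Y i ω) :=
    hf.measurable.comp (measurable_blockVar hY G)
  have hi : ∀ l, Integrable (fun ω => Y l ω * f (blockVar G fun i => Y i ω)) Pr := fun l =>
    ((hlaw l).integrable_comp (h := fun x => x) (hQ.integrable one_le_two)).mul_bdd
      hVm.aestronglyMeasurable (c := K) (ae_of_all _ fun ω => hK _)
  have heq : ∀ ω, f (blockVar G fun i => Y i ω) * blockMean G (fun i => Y i ω) =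
      (∑ l ∈ G, Y l ω * f (blockVar G fun i => Y i ω)) / G.card := by
    intro ω
    rw [← Finset.sum_mul, blockMean]
    ring
  simp_rw [heq]
  rw [integral_div, integral_finsetSum _ fun l _ => hi l, abs_div, abs_of_pos hc, div_le_iff₀ hc]
  refine (Finset.abs_sum_le_sum_abs _ _).trans ((Finset.sum_le_sum fun l hl =>
    abs_integral_mul_comp_blockVar_le hY hlaw hind hQ h0 hf hK hL hl).trans ?_)
  rw [Finset.sum_const, nsmul_eq_mul, mul_comm]

end Bias

lemma tailMoment_nonneg (P : Measure ℝ) (δ u : ℝ) : 0 ≤ tailMoment P δ u :=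
  integral_nonneg fun x => by positivity

lemma inv_le_biasRate (P : Measure ℝ) {δ : ℝ} (hδ₂ : δ ≤ 2) {n : ℕ} (hn : 1 ≤ n) :
    (n : ℝ)⁻¹ ≤ biasRate P δ n := by
  have hn1 : (1 : ℝ) ≤ n := by exact_mod_cast hn
  have hn0 : (0 : ℝ) < n := by linarith
  calc (n : ℝ)⁻¹ = (n : ℝ) ^ (-1 : ℝ) := (Real.rpow_neg_one _).symm
    _ ≤ (n : ℝ) ^ (-δ / 2 + -(2 - δ) / 4) := Real.rpow_le_rpow_of_exponent_le hn1 (by linarith)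
    _ = (n : ℝ) ^ (-δ / 2) * (n : ℝ) ^ (-(2 - δ) / 4) := Real.rpow_add hn0 _ _
    _ ≤ biasRate P δ n := by
      unfold biasRate
      gcongr
      exact le_max_left _ _

lemma memLp_of_integrable_abs_sub_rpow {P : Measure ℝ} [IsFiniteMeasure P] {μ q : ℝ} (hq : 0 < q)
    (h : Integrable (fun x : ℝ => |x - μ| ^ q) P) :
    MemLp (fun x : ℝ => x) (ENNReal.ofReal q) P := by
  have h1 : MemLp (fun x : ℝ => x - μ) (ENNReal.ofReal q) P := by
    rw [← integrable_norm_rpow_iff (by fun_prop) (by simpa using hq) ENNReal.ofReal_ne_top]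
    simpa [ENNReal.toReal_ofReal hq.le] using h
  have h2 := h1.add (memLp_const μ)
  refine h2.congr_norm (by fun_prop) (ae_of_all _ fun x => ?_)
  simp

/-- The truncated third moment `E (|X - μ| min(1, (X - μ)² / n))` is at most of the order of
`biasRate`. For `|X| < n ^ (1/4)` use the bound `|X - μ|³ / n`, which gives the first term of the
maximum; for `|X| ≥ n ^ (1/4)` use `min(1, y²) ≤ y ^ δ`, which gives `n ^ (-δ/2) g(n ^ (1/4))`. The
exponent `(2 - δ) / (2 + δ) ≤ 1` on `g` is harmless because `g` is bounded. -/
lemma exists_integral_truncated_le_biasRate {P : Measure ℝ} [IsProbabilityMeasure P] {μ δ : ℝ}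
    (hδ₁ : 1 ≤ δ) (hδ₂ : δ ≤ 2) (hmom : Integrable (fun x : ℝ => |x - μ| ^ (1 + δ)) P) :
    ∃ C : ℝ, ∃ n₀ : ℕ, ∀ n : ℕ, n₀ ≤ n →
      ∫ x, |x - μ| * min 1 ((x - μ) ^ 2 / n) ∂P ≤ C * biasRate P δ n := by
  have hmom' : Integrable (fun x : ℝ => |x| ^ (1 + δ)) P := by
    have h1 := (memLp_of_integrable_abs_sub_rpow (by linarith) hmom).integrable_norm_rpow
      (by simp; linarith) ENNReal.ofReal_ne_top
    simpa [ENNReal.toReal_ofReal (show 0 ≤ 1 + δ by linarith)] using h1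
  set M := ∫ x, |x - μ| ^ (1 + δ) ∂P
  set M' := ∫ x, |x| ^ (1 + δ) ∂P
  set θ := (2 - δ) / (2 + δ) with hθ
  have hθ0 : 0 ≤ θ := div_nonneg (by linarith) (by linarith)
  have hθ1 : θ ≤ 1 := by rw [hθ, div_le_one (by linarith)]; linarith
  have hM : 0 ≤ M := integral_nonneg fun x => by positivity
  have hM' : 0 ≤ M' := integral_nonneg fun x => by positivity
  refine ⟨2 * M + 8 * M' ^ (1 - θ), max 1 ⌈|μ| ^ 4⌉₊, fun n hn => ?_⟩
  have hn1 : (1 : ℝ) ≤ n := by exact_mod_cast (le_max_left _ _).trans hn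
  have hn0 : (0 : ℝ) < n := by linarith
  set u := (n : ℝ) ^ (1 / 4 : ℝ) with hu
  have hu0 : 0 < u := by positivity
  have hu4 : u ^ (4 : ℝ) = n := by
    rw [hu, ← Real.rpow_mul hn0.le]
    norm_num
  have hμu : |μ| ≤ u := by
    have h1 : |μ| ^ 4 ≤ n := (Nat.le_ceil _).trans (by exact_mod_cast (le_max_right _ _).trans hn)
    have h2 : |μ| ^ 4 ≤ u ^ 4 := by
      refine h1.trans (le_of_eq ?_)
      rw [← hu4]
      norm_cast
    exact le_of_pow_le_pow_left₀ (by norm_num) hu0.le h2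
  set g := tailMoment P δ u with hg
  have hg0 : 0 ≤ g := tailMoment_nonneg _ _ _
  have hgM : g ≤ M' := setIntegral_le_integral hmom' (ae_of_all _ fun x => by positivity)
  have hgθ : g ≤ M' ^ (1 - θ) * g ^ θ := by
    rcases hg0.eq_or_lt with h | h
    · rw [← h]; positivity
    · calc g = g ^ (1 - θ) * g ^ θ := by
            rw [← Real.rpow_add h, sub_add_cancel, Real.rpow_one]
        _ ≤ _ := by
          gcongr
  set q := (n : ℝ) ^ (-δ / 2) with hq
  have hq0 : 0 < q := by positivity
  set r := (n : ℝ) ^ (-(2 - δ) / 4) with hr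
  have hr0 : 0 < r := by positivity
  have hS : MeasurableSet {x : ℝ | u ≤ |x|} := measurableSet_le measurable_const measurable_norm
  have hpt : ∀ x, |x - μ| * min 1 ((x - μ) ^ 2 / n) ≤
      2 * q * r * |x - μ| ^ (1 + δ) + 8 * q * {x : ℝ | u ≤ |x|}.indicator
        (fun x => |x| ^ (1 + δ)) x := by
    intro x
    set w := |x - μ| with hw
    have hw0 : 0 ≤ w := abs_nonneg _
    rw [← sq_abs (x - μ), ← hw]
    have hcube : w * w ^ 2 = w ^ (1 + δ) * w ^ (2 - δ) := by
      rw [← Real.rpow_add_of_nonneg hw0 (by linarith) (by linarith)]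
      norm_num
      ring
    by_cases hx : u ≤ |x|
    · have hmem : x ∈ {x : ℝ | u ≤ |x|} := hx
      rw [Set.indicator_of_mem hmem]
      have h1 : w * min 1 (w ^ 2 / n) ≤ q * w ^ (1 + δ) := by
        rcases le_total w ((n : ℝ) ^ (1 / 2 : ℝ)) with h | h
        · calc w * min 1 (w ^ 2 / n) ≤ w * (w ^ 2 / n) := by gcongr; exact min_le_right _ _
            _ = w ^ (1 + δ) * w ^ (2 - δ) / n := by rw [← hcube]; ring
            _ ≤ w ^ (1 + δ) * ((n : ℝ) ^ (1 / 2 : ℝ)) ^ (2 - δ) / n := by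
              gcongr
            _ = q * w ^ (1 + δ) := by
              rw [← Real.rpow_mul hn0.le, mul_div_assoc, hq]
              nth_rewrite 2 [← Real.rpow_one (n : ℝ)]
              rw [← Real.rpow_sub hn0, mul_comm]
              ring_nf
        · have h2 : 1 ≤ q * w ^ δ := by
            calc 1 = q * ((n : ℝ) ^ (1 / 2 : ℝ)) ^ δ := by
                  rw [hq, ← Real.rpow_mul hn0.le, ← Real.rpow_add hn0]
                  ring_nf
                  simp
              _ ≤ _ := by gcongr
          calc w * min 1 (w ^ 2 / n) ≤ w * (q * w ^ δ) := by
                gcongr; exact (min_le_left _ _).trans h2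
            _ = q * w ^ (1 + δ) := by
              rw [Real.rpow_add_of_nonneg hw0 zero_le_one (by linarith), Real.rpow_one]
              ring
      have h2 : w ≤ 2 * |x| := (abs_sub _ _).trans (by linarith)
      have h3 : w ^ (1 + δ) ≤ 8 * |x| ^ (1 + δ) := by
        calc w ^ (1 + δ) ≤ (2 * |x|) ^ (1 + δ) := by gcongr
          _ = 2 ^ (1 + δ) * |x| ^ (1 + δ) := Real.mul_rpow two_pos.le (abs_nonneg _)
          _ ≤ 2 ^ (3 : ℝ) * |x| ^ (1 + δ) := by
            gcongr
            · norm_num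
            · linarith
          _ = _ := by norm_num
      have h4 : 0 ≤ 2 * q * r * w ^ (1 + δ) := by positivity
      calc w * min 1 (w ^ 2 / n) ≤ q * (8 * |x| ^ (1 + δ)) := h1.trans (by gcongr)
        _ ≤ _ := by linarith
    · have hmem : x ∉ {x : ℝ | u ≤ |x|} := hx
      rw [Set.indicator_of_notMem hmem]
      have h2 : w ≤ 2 * u := (abs_sub _ _).trans (by linarith [not_le.1 hx])
      have h5 : (2 : ℝ) ^ (2 - δ) ≤ 2 := by
        calc (2 : ℝ) ^ (2 - δ) ≤ 2 ^ (1 : ℝ) :=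
              Real.rpow_le_rpow_of_exponent_le one_le_two (by linarith)
          _ = 2 := Real.rpow_one 2
      calc w * min 1 (w ^ 2 / n) ≤ w * (w ^ 2 / n) := by gcongr; exact min_le_right _ _
        _ = w ^ (1 + δ) * w ^ (2 - δ) / n := by rw [← hcube]; ring
        _ ≤ w ^ (1 + δ) * (2 * u) ^ (2 - δ) / n := by
          gcongr
        _ = w ^ (1 + δ) * (2 ^ (2 - δ) * u ^ (2 - δ)) / n := by
          rw [Real.mul_rpow two_pos.le hu0.le]
        _ ≤ w ^ (1 + δ) * (2 * u ^ (2 - δ)) / n := by gcongr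
        _ = 2 * (u ^ (2 - δ) / n) * w ^ (1 + δ) := by ring
        _ = 2 * (q * r) * w ^ (1 + δ) := by
          congr 2
          rw [hu, hq, hr, ← Real.rpow_mul hn0.le, ← Real.rpow_add hn0]
          nth_rewrite 2 [← Real.rpow_one (n : ℝ)]
          rw [← Real.rpow_sub hn0]
          ring_nf
        _ = _ := by ring
  have hi2 : Integrable ({x : ℝ | u ≤ |x|}.indicator (fun x => |x| ^ (1 + δ))) P :=
    hmom'.indicator hS
  refine (integral_mono_of_nonneg (ae_of_all _ fun x => by positivity)
    ((hmom.const_mul _).add (hi2.const_mul _)) (ae_of_all _ hpt)).trans ?_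
  simp only [Pi.add_apply]
  rw [integral_add (hmom.const_mul _) (hi2.const_mul _), integral_const_mul, integral_const_mul,
    integral_indicator hS]
  change 2 * q * r * M + 8 * q * g ≤ (2 * M + 8 * M' ^ (1 - θ)) * (q * max r (g ^ θ))
  have h1 : 2 * q * r * M ≤ 2 * M * (q * max r (g ^ θ)) := by
    have : r ≤ max r (g ^ θ) := le_max_left _ _
    calc 2 * q * r * M = 2 * M * (q * r) := by ring
      _ ≤ _ := by gcongr
  have h2 : 8 * q * g ≤ 8 * M' ^ (1 - θ) * (q * max r (g ^ θ)) := by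
    have h3 : g ^ θ ≤ max r (g ^ θ) := le_max_right _ _
    calc 8 * q * g ≤ 8 * q * (M' ^ (1 - θ) * g ^ θ) := by gcongr
      _ = 8 * M' ^ (1 - θ) * (q * g ^ θ) := by ring
      _ ≤ _ := by gcongr
  linarith

/-! ### Weights -/

section Weight

lemma exists_lipschitz_rpow_max {c : ℝ} (hc : 0 < c) {p : ℝ} (hp : 0 ≤ p) :
    ∃ L : ℝ, ∀ x y : ℝ, |max x c ^ (-(p / 2)) - max y c ^ (-(p / 2))| ≤ L * |x - y| := by
  set L := p / 2 * c ^ (-(p / 2) - 1)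
  have hL : 0 ≤ L := by positivity
  refine ⟨L, fun x y => ?_⟩
  have h := Convex.norm_image_sub_le_of_norm_hasDerivWithin_le (s := Set.Ici c)
    (f := fun t : ℝ => t ^ (-(p / 2))) (f' := fun t => -(p / 2) * t ^ (-(p / 2) - 1)) (C := L)
    (fun t ht => (Real.hasDerivAt_rpow_const (Or.inl
      (hc.trans_le ht).ne')).hasDerivWithinAt) (fun t ht => ?_) (convex_Ici c)
    (le_max_right y c) (le_max_right x c)
  · refine h.trans (mul_le_mul_of_nonneg_left ?_ hL)
    exact abs_max_sub_max_le_abs x y c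
  · have ht0 : 0 < t := hc.trans_le ht
    rw [norm_mul, norm_neg, Real.norm_of_nonneg (by positivity), Real.norm_of_nonneg (by positivity)]
    exact mul_le_mul_of_nonneg_left (Real.rpow_le_rpow_of_nonpos hc ht (by linarith))
      (by positivity)

lemma rpow_max_le {c : ℝ} (hc : 0 < c) {p : ℝ} (hp : 0 ≤ p) (x : ℝ) :
    |max x c ^ (-(p / 2))| ≤ c ^ (-(p / 2)) := by
  have : 0 < max x c := lt_max_of_lt_right hc
  rw [abs_of_pos (by positivity)]
  exact Real.rpow_le_rpow_of_nonpos hc (le_max_right _ _) (by linarith)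

lemma continuous_rpow_max {c : ℝ} (hc : 0 < c) (p : ℝ) :
    Continuous fun x : ℝ => max x c ^ (-(p / 2)) :=
  (continuous_id.max continuous_const).rpow_const fun _ =>
    Or.inl (lt_max_of_lt_right hc).ne'

/-- When every block variance is at least `c > 0`, the weights `1 / s ^ p` may be replaced by the
bounded Lipschitz function `max s² c ^ (-p / 2)` of the block variance. -/
lemma weightedBlockEstimator_eq {c : ℝ} (hc : 0 < c) (p : ℝ) {k : ℕ} {G : Fin k → Finset ℕ}
    {x : ℕ → ℝ} (hG : ∀ i, (G i).Nonempty) (hx : ∀ i, c ≤ blockVar (G i) x) :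
    weightedBlockEstimator p G x =
      (∑ i, max (blockVar (G i) x) c ^ (-(p / 2)) * blockMean (G i) x) /
        ∑ i, max (blockVar (G i) x) c ^ (-(p / 2)) := by
  have hraw : ∀ i, rawWeight p (fun l => blockStd (G l) x) i =
      max (blockVar (G i) x) c ^ (-(p / 2)) := by
    intro i
    have h0 : ¬ ∃ l, blockStd (G l) x = 0 := by
      rintro ⟨l, hl⟩
      rw [blockStd_eq_sqrt_blockVar (hG l), Real.sqrt_eq_zero'] at hl
      linarith [hx l]
    have hV : 0 ≤ blockVar (G i) x := hc.le.trans (hx i)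
    rw [rawWeight, if_neg h0, max_eq_left (hx i), blockStd_eq_sqrt_blockVar (hG i),
      Real.sqrt_eq_rpow, ← Real.rpow_mul hV, Real.rpow_neg hV, one_div]
    ring_nf
  simp only [weightedBlockEstimator, blockWeight, hraw]
  rw [Finset.sum_div]
  exact Finset.sum_congr rfl fun i _ => by ring

lemma sum_blockWeight {p : ℝ} {k : ℕ} (hk : 0 < k) {s : Fin k → ℝ} (hs : ∀ i, 0 ≤ s i) :
    ∑ i, blockWeight p s i = 1 := by
  have : Nonempty (Fin k) := ⟨⟨0, hk⟩⟩
  have hpos : 0 < ∑ i, rawWeight p s i := by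
    by_cases h : ∃ l, s l = 0
    · obtain ⟨l, hl⟩ := h
      refine Finset.sum_pos' (fun i _ => ?_) ⟨l, Finset.mem_univ _, ?_⟩
      · rw [rawWeight, if_pos ⟨l, hl⟩]
        split_ifs <;> norm_num
      · rw [rawWeight, if_pos ⟨l, hl⟩, if_pos hl]
        exact one_pos
    · refine Finset.sum_pos (fun i _ => ?_) Finset.univ_nonempty
      rw [rawWeight, if_neg h]
      have : 0 < s i := (hs i).lt_of_ne fun h' => h ⟨i, h'.symm⟩
      positivity
  simp only [blockWeight]
  rw [← Finset.sum_div, div_self hpos.ne']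

lemma weightedBlockEstimator_sub_const {p : ℝ} {k : ℕ} (hk : 0 < k) {G : Fin k → Finset ℕ}
    (hG : ∀ i, (G i).Nonempty) (x : ℕ → ℝ) (μ : ℝ) :
    weightedBlockEstimator p G (fun i => x i - μ) = weightedBlockEstimator p G x - μ := by
  have hmean : ∀ i, blockMean (G i) (fun i => x i - μ) = blockMean (G i) x - μ := fun i => by
    rw [blockMean_sub, blockMean_const (hG i)]
  have hstd : ∀ i, blockStd (G i) (fun i => x i - μ) = blockStd (G i) x := fun i => by
    simp only [blockStd, hmean, sub_sub_sub_cancel_right]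
  simp only [weightedBlockEstimator, hmean, hstd, mul_sub]
  rw [Finset.sum_sub_distrib, ← Finset.sum_mul,
    sum_blockWeight hk (s := fun l => blockStd (G l) x) fun i => Real.sqrt_nonneg _, one_mul]

lemma measurable_weightedBlockEstimator {Ω : Type*} [MeasurableSpace Ω] {Y : ℕ → Ω → ℝ}
    (hY : ∀ i, Measurable (Y i)) (p : ℝ) {k : ℕ} (G : Fin k → Finset ℕ) :
    Measurable fun ω => weightedBlockEstimator p G fun i => Y i ω := by
  have hstd : ∀ i, Measurable fun ω => blockStd (G i) fun i => Y i ω := by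
    intro i
    unfold blockStd blockMean
    fun_prop
  have hex : MeasurableSet {ω | ∃ l, blockStd (G l) (fun i => Y i ω) = 0} := by
    rw [Set.ofPred_exists]
    exact MeasurableSet.iUnion fun l => measurableSet_eq_fun (hstd l) measurable_const
  have hraw : ∀ i, Measurable fun ω => rawWeight p (fun l => blockStd (G l) fun i => Y i ω) i := by
    intro i
    unfold rawWeight
    refine Measurable.ite hex (Measurable.ite
      (measurableSet_eq_fun (hstd i) measurable_const) measurable_const measurable_const) ?_
    exact measurable_const.div ((hstd i).pow_const p)
  unfold weightedBlockEstimator blockWeight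
  exact Finset.measurable_sum _ fun i _ => ((hraw i).div
    (Finset.measurable_sum _ fun i _ => hraw i)).mul (measurable_blockMean hY (G i))

end Weight

section InMeasure

variable {Ω : Type*} [MeasurableSpace Ω] {Pr : Measure Ω}

lemma tendsto_measureReal_of_tendsto_integral {A : ℕ → Ω → ℝ} (h0 : ∀ j ω, 0 ≤ A j ω)
    (hi : ∀ j, Integrable (A j) Pr) (hA : Tendsto (fun j => ∫ ω, A j ω ∂Pr) atTop (𝓝 0))
    {ε : ℝ} (hε : 0 < ε) : Tendsto (fun j => Pr.real {ω | ε ≤ A j ω}) atTop (𝓝 0) := by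
  have h1 : Tendsto (fun j => (∫ ω, A j ω ∂Pr) / ε) atTop (𝓝 0) := by
    simpa using hA.div_const ε
  refine squeeze_zero (fun j => measureReal_nonneg) (fun j => ?_) h1
  rw [le_div_iff₀ hε, mul_comm]
  exact mul_meas_ge_le_integral_of_nonneg (ae_of_all _ (h0 j)) (hi j) ε

lemma tendstoInMeasure_zero_of_tendsto_integral_sq [IsFiniteMeasure Pr] {A : ℕ → Ω → ℝ}
    (hi : ∀ j, MemLp (A j) 2 Pr) (hA : Tendsto (fun j => ∫ ω, A j ω ^ 2 ∂Pr) atTop (𝓝 0)) :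
    TendstoInMeasure Pr A atTop fun _ => 0 := by
  rw [tendstoInMeasure_iff_measureReal_norm]
  intro ε hε
  refine (tendsto_measureReal_of_tendsto_integral (fun j ω => sq_nonneg (A j ω))
    (fun j => (hi j).integrable_sq) hA (pow_pos hε 2)).congr fun j => ?_
  congr 1
  ext ω
  simp only [Set.mem_ofPred_eq, sub_zero, Real.norm_eq_abs]
  rw [← sq_abs (A j ω)]
  exact pow_le_pow_iff_left₀ hε.le (abs_nonneg _) two_ne_zero

/-- Second moment of a sum of pairwise independent variables, not necessarily centred. -/
lemma integral_sq_sum_le [IsProbabilityMeasure Pr] {ι : Type*} [Fintype ι] {ξ : ι → Ω → ℝ}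
    (hξ : ∀ i, MemLp (ξ i) 2 Pr) (hind : Pairwise fun i l => IndepFun (ξ i) (ξ l) Pr) :
    ∫ ω, (∑ i, ξ i ω) ^ 2 ∂Pr ≤ ∑ i, ∫ ω, ξ i ω ^ 2 ∂Pr + (∑ i, ∫ ω, ξ i ω ∂Pr) ^ 2 := by
  have hS : MemLp (∑ i, ξ i) 2 Pr := memLp_finsetSum' _ fun i _ => hξ i
  have hvar := IndepFun.variance_sum (s := Finset.univ) (X := ξ) (fun i _ => hξ i)
    fun i _ l _ hil => hind hil
  rw [variance_eq_sub hS] at hvar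
  have hmean : ∫ ω, (∑ i, ξ i) ω ∂Pr = ∑ i, ∫ ω, ξ i ω ∂Pr := by
    simp only [Finset.sum_apply]
    exact integral_finsetSum _ fun i _ => (hξ i).integrable one_le_two
  rw [hmean] at hvar
  simp only [Pi.pow_apply, Finset.sum_apply] at hvar
  have hle : ∑ i, Var[ξ i; Pr] ≤ ∑ i, ∫ ω, ξ i ω ^ 2 ∂Pr :=
    Finset.sum_le_sum fun i _ => by
      have := variance_le_expectation_sq (hξ i).aestronglyMeasurable
      simpa only [Pi.pow_apply] using this
  linarith

end InMeasure

/-! ### Averages over the blocks -/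

section Blocks

variable {Ω : Type*} [MeasurableSpace Ω] {Pr : Measure Ω} [IsProbabilityMeasure Pr]
  {Q : Measure ℝ} {Y : ℕ → Ω → ℝ} {v K L : ℝ} {f : ℝ → ℝ}

lemma nonneg_of_abs_sub_le (hL : ∀ x y, |f x - f y| ≤ L * |x - y|) : 0 ≤ L := by
  simpa using (abs_nonneg _).trans (hL 1 0)

lemma integrable_comp_blockVar_sub (hY : ∀ i, Measurable (Y i)) (hf : Continuous f)
    (hK : ∀ x, |f x| ≤ K) (G : Finset ℕ) (a : ℝ) :
    Integrable (fun ω => f (blockVar G fun i => Y i ω) - a) Pr :=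
  (Integrable.of_bound (hf.measurable.comp (measurable_blockVar hY G)).aestronglyMeasurable K
    (ae_of_all _ fun _ => hK _)).sub (integrable_const _)

lemma memLp_comp_blockVar_sub_mul_blockMean (hY : ∀ i, Measurable (Y i))
    (hlaw : ∀ i, HasLaw (Y i) Q Pr) (hQ : MemLp (fun x : ℝ => x) 2 Q) (hf : Continuous f)
    (hK : ∀ x, |f x| ≤ K) (G : Finset ℕ) (a : ℝ) :
    MemLp (fun ω => (f (blockVar G fun i => Y i ω) - a) * blockMean G fun i => Y i ω) 2 Pr := by
  refine MemLp.mul (p := ∞) (q := 2) (memLp_blockMean hlaw (h := fun x => x) hQ G)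
    (memLp_top_of_bound (integrable_comp_blockVar_sub hY hf hK G a).aestronglyMeasurable
      (K + |a|) (ae_of_all _ fun ω => ?_))
  exact (abs_sub _ _).trans (by linarith [hK (blockVar G fun i => Y i ω)])

variable [IsProbabilityMeasure Q]

/-- A Lipschitz function of the block variance converges in `L¹`, uniformly over all blocks of large
cardinality. -/
lemma exists_forall_integral_abs_comp_blockVar_sub_le
    (hlaw : ∀ i, HasLaw (Y i) Q Pr) (hind : iIndepFun Y Pr) (hQ : MemLp (fun x : ℝ => x) 2 Q)
    (h0 : ∫ x, x ∂Q = 0) (hv : ∫ x, x ^ 2 ∂Q = v)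
    (hL : ∀ x y, |f x - f y| ≤ L * |x - y|) {ε : ℝ} (hε : 0 < ε) :
    ∃ n₀ : ℕ, ∀ G : Finset ℕ, G.Nonempty → n₀ ≤ G.card →
      ∫ ω, |f (blockVar G fun i => Y i ω) - f v| ∂Pr ≤ ε := by
  have hL0 := nonneg_of_abs_sub_le hL
  have hsq : Integrable (fun x : ℝ => x ^ 2) Q := hQ.integrable_sq
  have hη : 0 < ε / (2 * (L + 1)) := by positivity
  obtain ⟨n₁, hn₁⟩ := exists_forall_integral_abs_blockMean_sub_le hlaw hind hsq hη
  refine ⟨max n₁ ⌈v / (ε / (2 * (L + 1)))⌉₊, fun G hG hn => ?_⟩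
  have hc : (0 : ℝ) < G.card := by exact_mod_cast hG.card_pos
  have h1 := hn₁ G hG ((le_max_left _ _).trans hn)
  have h2 : v / G.card ≤ ε / (2 * (L + 1)) := by
    have : v / (ε / (2 * (L + 1))) ≤ G.card :=
      (Nat.le_ceil _).trans (by exact_mod_cast (le_max_right _ _).trans hn)
    rw [div_le_iff₀ hη] at this
    rw [div_le_iff₀ hc, mul_comm]
    exact this
  rw [hv] at h1
  have hm2 := memLp_blockMean hlaw (h := fun x => x) hQ G
  have hi1 : Integrable (fun ω => |blockMean G (fun i => Y i ω ^ 2) - v|) Pr :=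
    ((integrable_blockMean hlaw hsq G).sub (integrable_const _)).abs
  have hi2 : Integrable (fun ω => (blockMean G fun i => Y i ω) ^ 2) Pr := hm2.integrable_sq
  have hpt : ∀ ω, |f (blockVar G fun i => Y i ω) - f v| ≤
      L * (|blockMean G (fun i => Y i ω ^ 2) - v| + (blockMean G fun i => Y i ω) ^ 2) := by
    intro ω
    refine (hL _ _).trans (mul_le_mul_of_nonneg_left ?_ hL0)
    rw [blockVar, sub_right_comm]
    refine (abs_sub _ _).trans ?_
    rw [abs_of_nonneg (sq_nonneg (blockMean G _))]
  refine (integral_mono_of_nonneg (ae_of_all _ fun ω => abs_nonneg _)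
    ((hi1.add hi2).const_mul L) (ae_of_all _ hpt)).trans ?_
  rw [integral_const_mul]
  simp only [Pi.add_apply]
  rw [integral_add hi1 hi2, integral_sq_blockMean hlaw hind (h := fun x => x) measurable_id hQ h0,
    hv]
  calc L * (∫ ω, |blockMean G (fun i => Y i ω ^ 2) - v| ∂Pr + v / G.card)
      ≤ L * (ε / (2 * (L + 1)) + ε / (2 * (L + 1))) := by gcongr
    _ ≤ (L + 1) * (ε / (2 * (L + 1)) + ε / (2 * (L + 1))) := by
      gcongr
      linarith
    _ = ε := by
      field_simp
      ring

/-- The variance of the weighted remainder: the fluctuation of a weight is negligible in mean square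
even after multiplication with the normalised block mean. -/
lemma exists_forall_card_mul_integral_sq_le (hY : ∀ i, Measurable (Y i))
    (hlaw : ∀ i, HasLaw (Y i) Q Pr) (hind : iIndepFun Y Pr) (hQ : MemLp (fun x : ℝ => x) 2 Q)
    (h0 : ∫ x, x ∂Q = 0) (hv : ∫ x, x ^ 2 ∂Q = v) (hf : Continuous f) (hK0 : 0 < K)
    (hK : ∀ x, |f x| ≤ K) (hL : ∀ x y, |f x - f y| ≤ L * |x - y|) {ε : ℝ} (hε : 0 < ε) :
    ∃ n₀ : ℕ, ∀ G : Finset ℕ, G.Nonempty → n₀ ≤ G.card →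
      G.card * ∫ ω, ((f (blockVar G fun i => Y i ω) - f v) *
        blockMean G fun i => Y i ω) ^ 2 ∂Pr ≤ ε := by
  obtain ⟨η, hη, hη'⟩ := exists_forall_integral_sq_mul_blockMean_le hlaw hind hQ h0
    (by positivity : 0 < 2 * K) hε
  obtain ⟨n₀, hn₀⟩ := exists_forall_integral_abs_comp_blockVar_sub_le hlaw hind hQ h0 hv
    hL hη
  refine ⟨n₀, fun G hG hn => hη' G _ hG
    (integrable_comp_blockVar_sub hY hf hK G _).aestronglyMeasurable (fun ω => ?_) (hn₀ G hG hn)⟩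
  exact (abs_sub _ _).trans (by linarith [hK (blockVar G fun i => Y i ω), hK v])

/-- The bias of a weighted block mean is at most of the order of any rate that dominates `1 / n` and
the truncated third moment `E (|Y| min(1, Y² / n))`. -/
lemma exists_forall_abs_integral_le_mul_rate (hY : ∀ i, Measurable (Y i))
    (hlaw : ∀ i, HasLaw (Y i) Q Pr) (hind : iIndepFun Y Pr) (hQ : MemLp (fun x : ℝ => x) 2 Q)
    (h0 : ∫ x, x ∂Q = 0) (hf : Continuous f) (hK : ∀ x, |f x| ≤ K)
    (hL : ∀ x y, |f x - f y| ≤ L * |x - y|) {r : ℕ → ℝ} {C : ℝ}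
    {n₀ : ℕ} (hr : ∀ n : ℕ, 1 ≤ n → (n : ℝ)⁻¹ ≤ r n)
    (hC : ∀ n : ℕ, n₀ ≤ n → ∫ x, |x| * min 1 (x ^ 2 / n) ∂Q ≤ C * r n) (a : ℝ) :
    ∃ C' : ℝ, ∀ G : Finset ℕ, G.Nonempty → n₀ ≤ G.card →
      |∫ ω, (f (blockVar G fun i => Y i ω) - a) * blockMean G (fun i => Y i ω) ∂Pr| ≤
        C' * r G.card := by
  have hL0 := nonneg_of_abs_sub_le hL
  have hK0 : 0 ≤ K := (abs_nonneg _).trans (hK 0)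
  have hQ1 := hQ.integrable one_le_two
  set D := 2 * L * (∫ x, x ^ 2 ∂Q) * (∫ x, |x| ∂Q) with hD
  have hD0 : 0 ≤ D := by
    have h1 : 0 ≤ ∫ x, x ^ 2 ∂Q := integral_nonneg fun x => sq_nonneg x
    have h2 : 0 ≤ ∫ x, |x| ∂Q := integral_nonneg fun x => abs_nonneg x
    positivity
  refine ⟨(2 * K + L) * C + D, fun G hG hn => ?_⟩
  have hm : Integrable (fun ω => blockMean G fun i => Y i ω) Pr :=
    integrable_blockMean hlaw (h := fun x => x) hQ1 G
  have hfm : Integrable (fun ω => f (blockVar G fun i => Y i ω) * blockMean G fun i => Y i ω) Pr :=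
    hm.bdd_mul (c := K) (hf.measurable.comp (measurable_blockVar hY G)).aestronglyMeasurable
      (ae_of_all _ fun ω => hK _)
  have heq : ∫ ω, (f (blockVar G fun i => Y i ω) - a) * blockMean G (fun i => Y i ω) ∂Pr =
      ∫ ω, f (blockVar G fun i => Y i ω) * blockMean G (fun i => Y i ω) ∂Pr := by
    simp_rw [sub_mul]
    rw [integral_sub hfm (hm.const_mul a), integral_const_mul,
      integral_blockMean hlaw (h := fun x => x) hQ1 hG, h0, mul_zero, sub_zero]
  rw [heq]
  refine (abs_integral_comp_blockVar_mul_blockMean_le hY hlaw hind hQ h0 hf hK hL hG).trans ?_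
  rw [add_mul]
  refine add_le_add ?_ ?_
  · have hi : Integrable (fun x : ℝ => (2 * K + L) * (|x| * min 1 (x ^ 2 / G.card))) Q := by
      refine (hQ1.abs.mul_bdd (by fun_prop) (c := 1) (ae_of_all _ fun x => ?_)).const_mul _
      rw [Real.norm_of_nonneg (by positivity)]
      exact min_le_left _ _
    have hpt : ∀ x : ℝ, |x| * min (2 * K) (L * (x ^ 2 / G.card)) ≤
        (2 * K + L) * (|x| * min 1 (x ^ 2 / G.card)) := by
      intro x
      rw [mul_left_comm]
      refine mul_le_mul_of_nonneg_left ?_ (abs_nonneg x)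
      have h2 : 0 ≤ x ^ 2 / G.card := by positivity
      rw [mul_min_of_nonneg _ _ (by positivity)]
      exact min_le_min (by linarith) (mul_le_mul_of_nonneg_right (by linarith) h2)
    refine (integral_mono_of_nonneg (ae_of_all _ fun x => by positivity) hi
      (ae_of_all _ hpt)).trans ?_
    rw [integral_const_mul, mul_assoc]
    exact mul_le_mul_of_nonneg_left (hC _ hn) (by positivity)
  · rw [div_eq_mul_inv]
    exact mul_le_mul_of_nonneg_left (hr _ hG.card_pos) hD0

end Blocks

section Assembly

variable {Ω : Type*} [MeasurableSpace Ω] {Pr : Measure Ω} [IsProbabilityMeasure Pr]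
  {Q : Measure ℝ} [IsProbabilityMeasure Q] {Y : ℕ → Ω → ℝ} {v K L : ℝ} {f : ℝ → ℝ}
  {k n : ℕ → ℕ} {G : (j : ℕ) → Fin (k j) → Finset ℕ}

lemma IsBlockPartition.nonempty {k n : ℕ} {G : Fin k → Finset ℕ} (hG : IsBlockPartition k n G)
    (hn : 0 < n) (i : Fin k) : (G i).Nonempty := by
  rw [← Finset.card_pos, hG.card_eq]
  exact hn

lemma IsBlockPartition.sum_blockMean {k n : ℕ} {G : Fin k → Finset ℕ}
    (hG : IsBlockPartition k n G) (x : ℕ → ℝ) :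
    ∑ i, blockMean (G i) x = (∑ i ∈ Finset.range (k * n), x i) / n := by
  rw [← hG.cover, Finset.sum_biUnion fun i _ l _ hil => hG.pairwise_disjoint hil]
  simp only [blockMean, hG.card_eq]
  rw [Finset.sum_div]

/-- The average of the weights over the blocks converges in probability. -/
lemma tendstoInMeasure_average_comp_blockVar (hY : ∀ i, Measurable (Y i))
    (hlaw : ∀ i, HasLaw (Y i) Q Pr) (hind : iIndepFun Y Pr) (hQ : MemLp (fun x : ℝ => x) 2 Q)
    (h0 : ∫ x, x ∂Q = 0) (hv : ∫ x, x ^ 2 ∂Q = v) (hf : Continuous f) (hK : ∀ x, |f x| ≤ K)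
    (hL : ∀ x y, |f x - f y| ≤ L * |x - y|) (hk : Tendsto k atTop atTop)
    (hn : Tendsto n atTop atTop) (hG : ∀ j, IsBlockPartition (k j) (n j) (G j)) :
    TendstoInMeasure Pr (fun j ω => (∑ i, f (blockVar (G j i) fun l => Y l ω)) / k j) atTop
      fun _ => f v := by
  rw [tendstoInMeasure_iff_measureReal_norm]
  intro ε hε
  have hi : ∀ j i, Integrable (fun ω => f (blockVar (G j i) fun l => Y l ω) - f v) Pr :=
    fun j i => integrable_comp_blockVar_sub hY hf hK _ _
  have hint : ∀ j, Integrable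
      (fun ω => (∑ i, |f (blockVar (G j i) fun l => Y l ω) - f v|) / k j) Pr := fun j =>
    (integrable_finsetSum _ fun i _ => (hi j i).abs).div_const _
  have hlim : Tendsto (fun j => ∫ ω, (∑ i, |f (blockVar (G j i) fun l => Y l ω) - f v|) / k j ∂Pr)
      atTop (𝓝 0) := by
    rw [Metric.tendsto_nhds]
    intro e he
    obtain ⟨n₀, hn₀⟩ := exists_forall_integral_abs_comp_blockVar_sub_le hlaw hind hQ h0 hv
      hL (half_pos he)
    filter_upwards [hk.eventually_ge_atTop 1, hn.eventually_ge_atTop 1,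
      hn.eventually_ge_atTop n₀] with j hkj hnj hnj₀
    have hkj' : (0 : ℝ) < k j := by exact_mod_cast hkj
    rw [Real.dist_eq, sub_zero, abs_of_nonneg (integral_nonneg fun ω => by positivity),
      integral_div, integral_finsetSum _ fun i _ => (hi j i).abs, div_lt_iff₀ hkj']
    calc ∑ i, ∫ ω, |f (blockVar (G j i) fun l => Y l ω) - f v| ∂Pr ≤ ∑ _i : Fin (k j), e / 2 :=
          Finset.sum_le_sum fun i _ => hn₀ _ ((hG j).nonempty hnj i)
            (by rw [(hG j).card_eq]; exact hnj₀)
      _ < e * k j := by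
        rw [Finset.sum_const, Finset.card_univ, Fintype.card_fin, nsmul_eq_mul]
        nlinarith
  have hmark := tendsto_measureReal_of_tendsto_integral (fun j ω => by positivity) hint hlim hε
  refine squeeze_zero' (Eventually.of_forall fun j => measureReal_nonneg) ?_ hmark
  filter_upwards [hk.eventually_ge_atTop 1] with j hkj
  have hkj' : (0 : ℝ) < k j := by exact_mod_cast hkj
  refine measureReal_mono fun ω hω => ?_
  simp only [Set.mem_ofPred_eq, Real.norm_eq_abs] at hω ⊢
  refine hω.trans ?_
  have : (∑ i, f (blockVar (G j i) fun l => Y l ω)) / k j - f v =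
      (∑ i, (f (blockVar (G j i) fun l => Y l ω) - f v)) / k j := by
    rw [Finset.sum_sub_distrib]
    simp
    field_simp
  rw [this, abs_div, abs_of_pos hkj']
  gcongr
  exact Finset.abs_sum_le_sum_abs _ _

/-- The effect on the estimator of the fluctuation of the weights tends to `0` in probability: its
variance vanishes by `exists_forall_card_mul_integral_sq_le`, and its mean by the bias bound and the
assumption on the rate. -/
lemma tendstoInMeasure_weighted_remainder (hY : ∀ i, Measurable (Y i))
    (hlaw : ∀ i, HasLaw (Y i) Q Pr) (hind : iIndepFun Y Pr) (hQ : MemLp (fun x : ℝ => x) 2 Q)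
    (h0 : ∫ x, x ∂Q = 0) (hv : ∫ x, x ^ 2 ∂Q = v) (hf : Continuous f) (hK0 : 0 < K)
    (hK : ∀ x, |f x| ≤ K) (hL : ∀ x y, |f x - f y| ≤ L * |x - y|) {r : ℕ → ℝ} {C : ℝ}
    {n₀ : ℕ} (hr : ∀ n : ℕ, 1 ≤ n → (n : ℝ)⁻¹ ≤ r n)
    (hC : ∀ n : ℕ, n₀ ≤ n → ∫ x, |x| * min 1 (x ^ 2 / n) ∂Q ≤ C * r n)
    (hk : Tendsto k atTop atTop) (hn : Tendsto n atTop atTop)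
    (hrate : Tendsto (fun j => Real.sqrt ((k j * n j : ℕ) : ℝ) * r (n j)) atTop (𝓝 0))
    (hG : ∀ j, IsBlockPartition (k j) (n j) (G j)) :
    TendstoInMeasure Pr (fun j ω => Real.sqrt ((k j * n j : ℕ) : ℝ) / k j *
      ∑ i, (f (blockVar (G j i) fun l => Y l ω) - f v) * blockMean (G j i) fun l => Y l ω) atTop
      fun _ => 0 := by
  set ξ : (j : ℕ) → Fin (k j) → Ω → ℝ := fun j i ω =>
    (f (blockVar (G j i) fun l => Y l ω) - f v) * blockMean (G j i) fun l => Y l ω with hξ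
  have hξ2 : ∀ j i, MemLp (ξ j i) 2 Pr := fun j i =>
    memLp_comp_blockVar_sub_mul_blockMean hY hlaw hQ hf hK _ _
  have hξind : ∀ j, Pairwise fun i l => IndepFun (ξ j i) (ξ j l) Pr := by
    intro j i l hil
    have h1 := hind.indepFun_finset (G j i) (G j l) ((hG j).pairwise_disjoint hil) hY
    have hφ : ∀ S : Finset ℕ, ∃ φ : (S → ℝ) → ℝ, Measurable φ ∧ ∀ x : ℕ → ℝ,
        φ (fun i => x i) = (f (blockVar S x) - f v) * blockMean S x := by
      intro S
      have hfm := hf.measurable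
      refine ⟨fun y => (f ((∑ i, y i ^ 2) / S.card - ((∑ i, y i) / S.card) ^ 2) - f v) *
        ((∑ i, y i) / S.card), by fun_prop, fun x => ?_⟩
      simp only [blockVar, blockMean]
      rw [Finset.sum_coe_sort S fun i => x i ^ 2, Finset.sum_coe_sort S fun i => x i]
    obtain ⟨φ, hφm, hφ₁⟩ := hφ (G j i)
    obtain ⟨ψ, hψm, hψ₁⟩ := hφ (G j l)
    have e1 : ξ j i = φ ∘ fun ω (a : G j i) => Y a ω := by
      ext ω
      exact (hφ₁ fun l => Y l ω).symm
    have e2 : ξ j l = ψ ∘ fun ω (a : G j l) => Y a ω := by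
      ext ω
      exact (hψ₁ fun l => Y l ω).symm
    rw [e1, e2]
    exact h1.comp hφm hψm
  obtain ⟨C', hC'⟩ := exists_forall_abs_integral_le_mul_rate hY hlaw hind hQ h0 hf hK hL hr hC (f v)
  refine tendstoInMeasure_zero_of_tendsto_integral_sq
    (fun j => (memLp_finsetSum _ fun i _ => hξ2 j i).const_mul _) ?_
  rw [Metric.tendsto_nhds]
  intro e he
  obtain ⟨n₁, hn₁⟩ := exists_forall_card_mul_integral_sq_le hY hlaw hind hQ h0 hv hf hK0 hK hL
    (half_pos he)
  have hsmall : ∀ᶠ j in atTop,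
      (C' * (Real.sqrt ((k j * n j : ℕ) : ℝ) * r (n j))) ^ 2 < e / 2 := by
    have h1 : Tendsto (fun j => (C' * (Real.sqrt ((k j * n j : ℕ) : ℝ) * r (n j))) ^ 2) atTop
        (𝓝 0) := by
      simpa using (hrate.const_mul C').pow 2
    exact h1.eventually_lt_const (half_pos he)
  filter_upwards [hk.eventually_ge_atTop 1, hn.eventually_ge_atTop 1,
    hn.eventually_ge_atTop n₀, hn.eventually_ge_atTop n₁, hsmall] with j hkj hnj hnj₀ hnj₁ hsj
  have hkj' : (0 : ℝ) < k j := by exact_mod_cast hkj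
  have hnj' : (0 : ℝ) < n j := by exact_mod_cast hnj
  have hN : Real.sqrt ((k j * n j : ℕ) : ℝ) ^ 2 = k j * n j := by
    rw [Real.sq_sqrt (Nat.cast_nonneg _)]
    push_cast
    rfl
  have hN0 := Real.sqrt_nonneg ((k j * n j : ℕ) : ℝ)
  rw [Real.dist_eq, sub_zero, abs_of_nonneg (integral_nonneg fun ω => sq_nonneg _)]
  simp_rw [mul_pow]
  rw [integral_const_mul]
  have hA : ∑ i, ∫ ω, ξ j i ω ^ 2 ∂Pr ≤ k j * (e / 2 / n j) := by
    calc ∑ i, ∫ ω, ξ j i ω ^ 2 ∂Pr ≤ ∑ _i : Fin (k j), e / 2 / n j := by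
          refine Finset.sum_le_sum fun i _ => ?_
          rw [le_div_iff₀ hnj', mul_comm]
          have := hn₁ (G j i) ((hG j).nonempty hnj i) (by rw [(hG j).card_eq]; exact hnj₁)
          rwa [(hG j).card_eq] at this
      _ = k j * (e / 2 / n j) := by
        rw [Finset.sum_const, Finset.card_univ, Fintype.card_fin, nsmul_eq_mul]
  have hB : |∑ i, ∫ ω, ξ j i ω ∂Pr| ≤ k j * (C' * r (n j)) := by
    calc |∑ i, ∫ ω, ξ j i ω ∂Pr| ≤ ∑ _i : Fin (k j), C' * r (n j) := by
          refine (Finset.abs_sum_le_sum_abs _ _).trans (Finset.sum_le_sum fun i _ => ?_)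
          have := hC' (G j i) ((hG j).nonempty hnj i) (by rw [(hG j).card_eq]; exact hnj₀)
          rwa [(hG j).card_eq] at this
      _ = k j * (C' * r (n j)) := by
        rw [Finset.sum_const, Finset.card_univ, Fintype.card_fin, nsmul_eq_mul]
  have hB2 : (∑ i, ∫ ω, ξ j i ω ∂Pr) ^ 2 ≤ (k j * (C' * r (n j))) ^ 2 := by
    rw [← sq_abs (∑ i, ∫ ω, ξ j i ω ∂Pr)]
    gcongr
  have hsum := integral_sq_sum_le (hξ2 j) (hξind j)
  calc (Real.sqrt ((k j * n j : ℕ) : ℝ) / k j) ^ 2 * ∫ ω, (∑ i, ξ j i ω) ^ 2 ∂Pr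
      ≤ (Real.sqrt ((k j * n j : ℕ) : ℝ) / k j) ^ 2 *
        (k j * (e / 2 / n j) + (k j * (C' * r (n j))) ^ 2) := by
        gcongr
        linarith
    _ = e / 2 + (C' * (Real.sqrt ((k j * n j : ℕ) : ℝ) * r (n j))) ^ 2 := by
        rw [div_pow, mul_pow C', mul_pow (Real.sqrt _), hN]
        field_simp
    _ < e := by linarith

end Assembly

/-! ### The limit theorem -/

section Centred

variable {Ω : Type*} [MeasurableSpace Ω] {Pr : Measure Ω} [IsProbabilityMeasure Pr]
  {Q : Measure ℝ} {Y : ℕ → Ω → ℝ}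
  {k n : ℕ → ℕ} {G : (j : ℕ) → Fin (k j) → Finset ℕ}

/-- The rate is at least `1 / n`, so the rate condition forces `k / n → 0`. This is what makes
error probabilities of order `1 / n` in each of the `k` blocks negligible. -/
lemma tendsto_ratio_zero {r : ℕ → ℝ} (hr : ∀ n : ℕ, 1 ≤ n → (n : ℝ)⁻¹ ≤ r n)
    (hn : Tendsto n atTop atTop)
    (hrate : Tendsto (fun j => Real.sqrt ((k j * n j : ℕ) : ℝ) * r (n j)) atTop (𝓝 0)) :
    Tendsto (fun j => (k j : ℝ) / n j) atTop (𝓝 0) := by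
  have h1 : Tendsto (fun j => Real.sqrt ((k j * n j : ℕ) : ℝ) * (n j : ℝ)⁻¹) atTop (𝓝 0) := by
    refine squeeze_zero' (Eventually.of_forall fun j => by positivity) ?_ hrate
    filter_upwards [hn.eventually_ge_atTop 1] with j hj
    exact mul_le_mul_of_nonneg_left (hr _ hj) (Real.sqrt_nonneg _)
  have h2 := h1.pow 2
  rw [zero_pow two_ne_zero] at h2
  refine h2.congr' ?_
  filter_upwards [hn.eventually_ge_atTop 1] with j hj
  have : (0 : ℝ) < n j := by exact_mod_cast hj
  rw [mul_pow, Real.sq_sqrt (Nat.cast_nonneg _)]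
  push_cast
  field_simp

/-- The unweighted average of the block means is the overall sample mean, so that the central limit
theorem applies to it. -/
lemma tendstoInDistribution_sqrt_mul_average (hlaw : ∀ i, HasLaw (Y i) Q Pr)
    (hind : iIndepFun Y Pr) (hQ : MemLp (fun x : ℝ => x) 2 Q) (h0 : ∫ x, x ∂Q = 0)
    {v : ℝ≥0} (hv : ∫ x, x ^ 2 ∂Q = v) (hk : Tendsto k atTop atTop) (hn : Tendsto n atTop atTop)
    (hG : ∀ j, IsBlockPartition (k j) (n j) (G j)) :
    TendstoInDistribution (fun (j : ℕ) ω => Real.sqrt ((k j * n j : ℕ) : ℝ) / k j *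
      ∑ i, blockMean (G j i) fun l => Y l ω) atTop (fun z : ℝ => z) (fun _ => Pr)
      (gaussianReal 0 v) := by
  have hvar : Var[Y 0; Pr] = v := by
    rw [(hlaw 0).variance_eq, variance_of_integral_eq_zero aemeasurable_id h0, ← hv]
    rfl
  have hmean : ∫ ω, Y 0 ω ∂Pr = 0 := by rw [(hlaw 0).integral_eq, h0]
  have hclt := tendstoInDistribution_inv_sqrt_mul_sum_sub (P := Pr) (X := Y)
    (P' := gaussianReal 0 v) (Y := fun z => z)
    (by rw [hvar, Real.toNNReal_coe]; exact HasLaw.id)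
    ((hlaw 0).memLp_comp hQ) hind
    fun i => ⟨(hlaw i).aemeasurable, (hlaw 0).aemeasurable, by
      rw [(hlaw i).map_eq, (hlaw 0).map_eq]⟩
  have hN : Tendsto (fun j => k j * n j) atTop atTop := hk.atTop_mul_atTop₀ hn
  have hlim : TendstoInDistribution (fun (j : ℕ) ω => (Real.sqrt ((k j * n j : ℕ) : ℝ))⁻¹ *
      (∑ l ∈ Finset.range (k j * n j), Y l ω - ((k j * n j : ℕ) : ℝ) * ∫ ω, Y 0 ω ∂Pr)) atTop
      (fun z : ℝ => z) (fun _ => Pr) (gaussianReal 0 v) :=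
    ⟨fun j => hclt.forall_aemeasurable _, hclt.aemeasurable_limit, hclt.tendsto.comp hN⟩
  refine hlim.congr (fun j => ae_of_all _ fun ω => ?_) (by rfl)
  simp only
  rw [(hG j).sum_blockMean, hmean, mul_zero, sub_zero]
  have hs : Real.sqrt ((k j * n j : ℕ) : ℝ) ^ 2 = k j * n j := by
    rw [Real.sq_sqrt (Nat.cast_nonneg _)]
    push_cast
    rfl
  rcases Nat.eq_zero_or_pos (k j * n j) with h | h
  · simp [h]
  · have hk' : (0 : ℝ) < k j := by exact_mod_cast Nat.pos_of_mul_pos_right h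
    have hn' : (0 : ℝ) < n j := by exact_mod_cast Nat.pos_of_mul_pos_left h
    have hs0 : 0 < Real.sqrt ((k j * n j : ℕ) : ℝ) := by
      rw [Real.sqrt_pos]
      exact_mod_cast h
    generalize Real.sqrt ((k j * n j : ℕ) : ℝ) = s at hs hs0
    field_simp
    rw [hs]
    ring

/-- Asymptotic normality of the weighted estimator for centred observations with positive variance:
with probability tending to one, the normalised estimator equals `(R + c Z) / W`, where `Z` is the
normalised sample mean, `R → 0` is the weighted remainder and `W → c` is the average weight. -/
lemma tendstoInDistribution_of_centred [IsProbabilityMeasure Q] (hY : ∀ i, Measurable (Y i))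
    (hlaw : ∀ i, HasLaw (Y i) Q Pr) (hind : iIndepFun Y Pr) (hQ : MemLp (fun x : ℝ => x) 2 Q)
    (h0 : ∫ x, x ∂Q = 0) {v : ℝ≥0} (hv : ∫ x, x ^ 2 ∂Q = v) (hv0 : v ≠ 0) {p : ℝ} (hp : 0 ≤ p)
    {r : ℕ → ℝ} {C : ℝ} {n₀ : ℕ} (hr : ∀ n : ℕ, 1 ≤ n → (n : ℝ)⁻¹ ≤ r n)
    (hC : ∀ n : ℕ, n₀ ≤ n → ∫ x, |x| * min 1 (x ^ 2 / n) ∂Q ≤ C * r n)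
    (hk : Tendsto k atTop atTop) (hn : Tendsto n atTop atTop)
    (hrate : Tendsto (fun j => Real.sqrt ((k j * n j : ℕ) : ℝ) * r (n j)) atTop (𝓝 0))
    (hG : ∀ j, IsBlockPartition (k j) (n j) (G j)) :
    TendstoInDistribution (fun (j : ℕ) (ω : Ω) => Real.sqrt ((k j * n j : ℕ) : ℝ) *
      weightedBlockEstimator p (G j) (fun i => Y i ω)) atTop (fun z : ℝ => z) (fun _ => Pr)
      (gaussianReal 0 v) := by
  have hv' : (0 : ℝ) < v := by positivity
  have hc : (0 : ℝ) < v / 4 := by positivity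
  set f : ℝ → ℝ := fun x => max x (v / 4) ^ (-(p / 2)) with hf
  have hfc : Continuous f := continuous_rpow_max hc p
  set K : ℝ := (v / 4 : ℝ) ^ (-(p / 2))
  have hK0 : 0 < K := by positivity
  have hK : ∀ x, |f x| ≤ K := rpow_max_le hc hp
  obtain ⟨L, hL⟩ := exists_lipschitz_rpow_max hc hp
  set c := f v with hcdef
  have hc0 : 0 < c := by
    have : (0 : ℝ) < max (v : ℝ) (v / 4) := lt_max_of_lt_left hv'
    simp only [hcdef, hf]
    positivity
  set V : (j : ℕ) → Fin (k j) → Ω → ℝ := fun j i ω => blockVar (G j i) fun l => Y l ω with hV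
  set m : (j : ℕ) → Fin (k j) → Ω → ℝ := fun j i ω => blockMean (G j i) fun l => Y l ω with hm
  set s : ℕ → ℝ := fun j => Real.sqrt ((k j * n j : ℕ) : ℝ) with hs
  have hVm : ∀ j i, Measurable (V j i) := fun j i => measurable_blockVar hY _
  have hmm : ∀ j i, Measurable (m j i) := fun j i => measurable_blockMean hY _
  have hfm := hfc.measurable
  set W : ℕ → Ω → ℝ := fun j ω => (∑ i, f (V j i ω)) / k j with hW
  set Z : ℕ → Ω → ℝ := fun j ω => s j / k j * ∑ i, m j i ω with hZ
  set R : ℕ → Ω → ℝ := fun j ω => s j / k j * ∑ i, (f (V j i ω) - c) * m j i ω with hR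
  have hWlim : TendstoInMeasure Pr W atTop fun _ => c :=
    tendstoInMeasure_average_comp_blockVar hY hlaw hind hQ h0 hv hfc hK hL hk hn hG
  have hRlim : TendstoInMeasure Pr R atTop fun _ => 0 :=
    tendstoInMeasure_weighted_remainder hY hlaw hind hQ h0 hv hfc hK0 hK hL hr hC hk hn hrate hG
  have hZlim : TendstoInDistribution Z atTop (fun z : ℝ => z) (fun _ => Pr) (gaussianReal 0 v) :=
    tendstoInDistribution_sqrt_mul_average hlaw hind hQ h0 hv hk hn hG
  have hWm : ∀ j, Measurable (W j) := fun j => by fun_prop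
  have hRm : ∀ j, Measurable (R j) := fun j => by fun_prop
  -- Slutsky's theorem, applied to the numerator and to the quotient; the denominator is bounded
  -- below by `c / 2` to make the quotient a continuous function
  have hnum : TendstoInDistribution (fun (j : ℕ) ω => R j ω + c * Z j ω) atTop
      (fun z : ℝ => c * z) (fun _ => Pr) (gaussianReal 0 v) := by
    have := hZlim.continuous_comp_prodMk_of_tendstoInMeasure_const
      (g := fun q : ℝ × ℝ => q.2 + c * q.1) (by fun_prop) hRlim fun j => (hRm j).aemeasurable
    simpa only [zero_add] using this
  have hslut : TendstoInDistribution (fun (j : ℕ) ω => (R j ω + c * Z j ω) / max (W j ω) (c / 2))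
      atTop (fun z : ℝ => z) (fun _ => Pr) (gaussianReal 0 v) := by
    have := hnum.continuous_comp_prodMk_of_tendstoInMeasure_const
      (g := fun q : ℝ × ℝ => q.1 / max q.2 (c / 2))
      (continuous_fst.div (continuous_snd.max continuous_const) fun q =>
        (lt_max_of_lt_right (half_pos hc0)).ne') hWlim fun j => (hWm j).aemeasurable
    refine this.congr (fun j => by rfl) (ae_of_all _ fun z => ?_)
    simp only
    rw [max_eq_left (by linarith)]
    field_simp
  refine tendstoInDistribution_of_tendstoInMeasure_sub _ _ hslut ?_ fun j =>
    ((measurable_weightedBlockEstimator hY p (G j)).const_mul _).aemeasurable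
  obtain ⟨D, hD⟩ := exists_measureReal_blockVar_lt_le hlaw hind hQ h0 hv hv'
  rw [tendstoInMeasure_iff_measureReal_norm] at hWlim ⊢
  intro ε hε
  have hbad : Tendsto (fun j => D * ((k j : ℝ) / n j) +
      Pr.real {ω | c / 2 ≤ ‖W j ω - c‖}) atTop (𝓝 0) := by
    simpa using ((tendsto_ratio_zero hr hn hrate).const_mul D).add (hWlim (c / 2) (half_pos hc0))
  refine squeeze_zero' (Eventually.of_forall fun j => measureReal_nonneg) ?_ hbad
  filter_upwards [hk.eventually_ge_atTop 1, hn.eventually_ge_atTop 1] with j hkj hnj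
  have hkj' : (0 : ℝ) < k j := by exact_mod_cast hkj
  have hne := fun i => (hG j).nonempty hnj i
  -- the two sequences agree unless some block variance or the average weight is too small
  have hsub : {ω | ε ≤ ‖((fun (j : ℕ) (ω : Ω) => s j *
      weightedBlockEstimator p (G j) fun i => Y i ω) -
      fun (j : ℕ) ω => (R j ω + c * Z j ω) / max (W j ω) (c / 2)) j ω -
      (0 : ℕ → Ω → ℝ) j ω‖} ⊆
      (⋃ i, {ω | V j i ω < v / 4}) ∪ {ω | c / 2 ≤ ‖W j ω - c‖} := by
    intro ω hω
    by_contra hcon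
    simp only [Set.mem_union, Set.mem_iUnion, Set.mem_ofPred_eq, not_or, not_exists, not_lt,
      not_le, Real.norm_eq_abs] at hcon
    obtain ⟨h1, h2⟩ := hcon
    have h3 : c / 2 ≤ W j ω := by linarith [(abs_lt.1 h2).1]
    have h4 : 0 < W j ω := (half_pos hc0).trans_le h3
    have h5 : s j * weightedBlockEstimator p (G j) (fun i => Y i ω) =
        (R j ω + c * Z j ω) / max (W j ω) (c / 2) := by
      rw [max_eq_left h3, weightedBlockEstimator_eq hc p hne h1]
      change s j * ((∑ i, f (V j i ω) * m j i ω) / ∑ i, f (V j i ω)) = _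
      have h6 : ∑ i, f (V j i ω) * m j i ω =
          ∑ i, (f (V j i ω) - c) * m j i ω + c * ∑ i, m j i ω := by
        simp only [sub_mul]
        rw [Finset.sum_sub_distrib, Finset.mul_sum]
        ring
      have h7 : ∑ i, f (V j i ω) = k j * W j ω := by
        simp only [hW]
        field_simp
      rw [h6, h7]
      simp only [hR, hZ]
      field_simp
    simp only [Set.mem_ofPred_eq, Pi.sub_apply, Pi.zero_apply, h5, sub_self, norm_zero] at hω
    linarith
  refine (measureReal_mono hsub).trans ((measureReal_union_le _ _).trans ?_)
  gcongr
  refine (measureReal_iUnion_fintype_le _).trans ?_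
  calc ∑ i, Pr.real {ω | V j i ω < v / 4} ≤ ∑ _i : Fin (k j), D / n j :=
        Finset.sum_le_sum fun i _ => by
          have := hD (G j i) (hne i)
          rwa [(hG j).card_eq] at this
    _ = D * ((k j : ℝ) / n j) := by
      rw [Finset.sum_const, Finset.card_univ, Fintype.card_fin, nsmul_eq_mul]
      ring

/-- The degenerate case of zero variance, in which the observations vanish almost surely. -/
lemma tendstoInDistribution_of_ae_eq_zero (hY : ∀ i, Y i =ᵐ[Pr] 0) (p : ℝ)
    (hYm : ∀ i, Measurable (Y i)) :
    TendstoInDistribution (fun (j : ℕ) (ω : Ω) => Real.sqrt ((k j * n j : ℕ) : ℝ) *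
      weightedBlockEstimator p (G j) (fun i => Y i ω)) atTop (fun z : ℝ => z) (fun _ => Pr)
      (gaussianReal 0 0) := by
  have hest : ∀ j, (fun ω => Real.sqrt ((k j * n j : ℕ) : ℝ) *
      weightedBlockEstimator p (G j) (fun i => Y i ω)) =ᵐ[Pr] fun _ => 0 := by
    intro j
    filter_upwards [ae_all_iff.2 hY] with ω hω
    simp [weightedBlockEstimator, blockMean, hω]
  have hmap : ∀ j, Pr.map (fun ω => Real.sqrt ((k j * n j : ℕ) : ℝ) *
      weightedBlockEstimator p (G j) (fun i => Y i ω)) = Measure.dirac 0 := fun j => by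
    rw [Measure.map_congr (hest j), Measure.map_const]
    simp
  have hm : ∀ j, AEMeasurable (fun ω => Real.sqrt ((k j * n j : ℕ) : ℝ) *
      weightedBlockEstimator p (G j) (fun i => Y i ω)) Pr := fun j =>
    ((measurable_weightedBlockEstimator hYm p (G j)).const_mul _).aemeasurable
  refine tendstoInDistribution_of_identDistrib 0
    (fun j => ⟨hm 0, hm j, (hmap 0).trans (hmap j).symm⟩) ⟨hm 0, by fun_prop, ?_⟩
  rw [hmap 0, gaussianReal_zero_var, Measure.map_id']

end Centred

theorem theorem3 {Ω : Type*} [MeasurableSpace Ω] (Pr : Measure Ω) [IsProbabilityMeasure Pr]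
    (P : Measure ℝ) [IsProbabilityMeasure P]
    (μ : ℝ) (σ : ℝ≥0) (δ p : ℝ) (hδ₁ : 1 ≤ δ) (hδ₂ : δ ≤ 2) (hp : 1 ≤ p)
    -- `P` has mean `μ`, variance `σ ^ 2` and a finite absolute moment of order `1 + δ`
    (hmom : Integrable (fun x : ℝ => |x - μ| ^ (1 + δ)) P)
    (hμ : ∫ x, x ∂P = μ)
    (hσ : variance (fun x : ℝ => x) P = (σ : ℝ) ^ 2)
    -- the data are independent with law `P`
    (X : ℕ → Ω → ℝ) (hX : ∀ i, HasLaw (X i) P Pr) (hindep : iIndepFun X Pr)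
    -- numbers of blocks, block sizes, and blocks
    (k n : ℕ → ℕ) (hk : Tendsto k atTop atTop) (hn : Tendsto n atTop atTop)
    (hφ : Tendsto (fun j => Real.sqrt ((k j * n j : ℕ) : ℝ) * biasRate P δ (n j)) atTop (𝓝 0))
    (G : (j : ℕ) → Fin (k j) → Finset ℕ) (hG : ∀ j, IsBlockPartition (k j) (n j) (G j)) :
    TendstoInDistribution
        (fun (j : ℕ) (ω : Ω) => Real.sqrt ((k j * n j : ℕ) : ℝ) *
          (weightedBlockEstimator p (G j) (fun i => X i ω) - μ))
        atTop (fun z : ℝ => z) (fun _ => Pr) (gaussianReal 0 (σ ^ 2)) ∧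
      ((σ ^ 2 : ℝ≥0) : ℝ≥0∞) = minimaxAsymptoticVariance σ := by
  refine ⟨?_, (minimaxAsymptoticVariance_eq σ).symm⟩
  have hP2 : MemLp (fun x : ℝ => x) 2 P := by
    refine (memLp_of_integrable_abs_sub_rpow (by linarith) hmom).mono_exponent ?_
    rw [← ENNReal.ofReal_ofNat]
    exact ENNReal.ofReal_le_ofReal (by linarith)
  -- `HasLaw` gives almost everywhere measurable observations only: pass to measurable versions
  set X' : ℕ → Ω → ℝ := fun i => (hX i).aemeasurable.mk (X i)
  have hXX' : ∀ i, X i =ᵐ[Pr] X' i := fun i => (hX i).aemeasurable.ae_eq_mk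
  have hX'm : ∀ i, Measurable (X' i) := fun i => (hX i).aemeasurable.measurable_mk
  set Y : ℕ → Ω → ℝ := fun i ω => X' i ω - μ
  have hYm : ∀ i, Measurable (Y i) := fun i => (hX'm i).sub_const μ
  set Q : Measure ℝ := P.map fun x => x - μ with hQdef
  have hshift : Measurable fun x : ℝ => x - μ := by fun_prop
  have : IsProbabilityMeasure Q := Measure.isProbabilityMeasure_map hshift.aemeasurable
  have hYlaw : ∀ i, HasLaw (Y i) Q Pr := fun i =>
    (HasLaw.mk (by fun_prop) rfl : HasLaw (fun x : ℝ => x - μ) Q P).comp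
      ((hX i).congr (hXX' i).symm)
  have hYind : iIndepFun Y Pr :=
    (hindep.congr hXX').comp (fun _ x => x - μ) fun _ => hshift
  have hQ2 : MemLp (fun x : ℝ => x) 2 Q := by
    rw [hQdef, memLp_map_measure_iff (by fun_prop) (by fun_prop)]
    exact hP2.sub (memLp_const μ)
  have hQint : ∀ h : ℝ → ℝ, Measurable h → ∫ x, h x ∂Q = ∫ x, h (x - μ) ∂P := fun h hh =>
    integral_map hshift.aemeasurable hh.aestronglyMeasurable
  have hQ0 : ∫ x, x ∂Q = 0 := by
    rw [hQint (fun x => x) measurable_id, integral_sub (hP2.integrable one_le_two)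
      (integrable_const _), hμ]
    simp
  have hQv : ∫ x, x ^ 2 ∂Q = ((σ ^ 2 : ℝ≥0) : ℝ) := by
    rw [hQint (fun x => x ^ 2) (by fun_prop), NNReal.coe_pow, ← hσ,
      variance_eq_integral (by fun_prop), hμ]
  obtain ⟨C, n₀, hC⟩ := exists_integral_truncated_le_biasRate hδ₁ hδ₂ hmom
  have hcentred : TendstoInDistribution (fun (j : ℕ) (ω : Ω) => Real.sqrt ((k j * n j : ℕ) : ℝ) *
      weightedBlockEstimator p (G j) (fun i => Y i ω)) atTop (fun z : ℝ => z) (fun _ => Pr)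
      (gaussianReal 0 (σ ^ 2)) := by
    rcases eq_or_ne (σ ^ 2) 0 with hσ0 | hσ0
    · rw [hσ0]
      refine tendstoInDistribution_of_ae_eq_zero (fun i => ?_) p hYm
      have h1 : ∫ ω, Y i ω ^ 2 ∂Pr = 0 := by
        rw [(hYlaw i).integral_fun_comp (h := fun x => x ^ 2) (by fun_prop), hQv, hσ0]
        simp
      rw [integral_eq_zero_iff_of_nonneg (fun ω => sq_nonneg _)
        ((hYlaw i).memLp_comp hQ2).integrable_sq] at h1
      filter_upwards [h1] with ω hω
      simpa using hω
    · refine tendstoInDistribution_of_centred hYm hYlaw hYind hQ2 hQ0 hQv hσ0 (by linarith)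
        (r := biasRate P δ) (C := C) (n₀ := n₀) (fun n hn => inv_le_biasRate P hδ₂ hn)
        (fun n hn => ?_) hk hn hφ hG
      rw [hQint (fun x => |x| * min 1 (x ^ 2 / n)) (by fun_prop)]
      exact hC n hn
  refine hcentred.congr (fun j => ?_) (by rfl)
  filter_upwards [ae_all_iff.2 hXX'] with ω hω
  -- without observations both sides vanish, because of the factor `√0`
  rcases Nat.eq_zero_or_pos (k j * n j) with h | h
  · simp [h]
  · rw [weightedBlockEstimator_sub_const (Nat.pos_of_mul_pos_right h)
      fun i => (hG j).nonempty (Nat.pos_of_mul_pos_left h) i]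
    simp only [hω]
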